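/- **Model.** In the deterministic No-CD model there is an ID space $[N]=\{0,\dots,N-1\}$, where $N$ is known to all devices, and an unknown set $S\subseteq[N]$ of $n=|S|$ active devices, with $n\ge 2$. Time is divided into slots. In each slot every active device transmits a message (of unbounded size), listens, or stays idle. If exactly one device transmits, all listeners receive its message; if no device or at least two devices transmit, all listeners receive the same signal "silence". Transmitting and idle devices receive no signal. The action of a device in a slot is determined by $N$, its own ID and the signals it has received so far; local computation is free. The energy of a device is the number of slots in which it transmits or listens; the energy cost of an execution is the maximum energy of an active device, and its time is its number of slots. *Leader Election* is solved if exactly one active device designates itself the leader, all others designate themselves followers, and in the last slot the leader transmits a message while every follower listens. *Census* is solved if in the last slot some active device announces a list of the IDs of all active devices (all other active devices listening). Let $A(i,j)$ be the Ackermann function, given by $A(0,j)=j+1$, $A(i+1,0)=A(i,1)$, $A(i+1,j+1)=A(i,A(i+1,j))$, and let $\alpha(N)=\min\{i : A(i,i)\ge N\}$ be its inverse. **Theorem.** For every constant $c>0$ there are a deterministic No-CD algorithm and a constant $C$, both depending only on $c$, such that for all $N$ and all sets $S\subseteq[N]$ of active devices with $|S|\ge 2$ and $|S|\ge cN$, the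 algorithm solves both Leader Election and Census, with energy cost at most $C\,\alpha(N)$ and time at most $C\,N$. Moreover, define $a_0(j)=j^5$, $b_0(j)=2^j$ and, for $i\ge 1$, $$a_i(j)=a_{i-1}^{(j)}(j^4),\qquad b_i(j)=2^j\prod_{r=1}^{j} b_{i-1}\!\left(a_{i-1}^{(r-1)}(j^4)\right),$$ where $f^{(r)}$ is the $r$-fold iterate of $f$. Then $a_i(j)\ge A(i,j)$ and $b_i(j)\ge A(i,j)$ for all $i\ge 0$ and $j>32$. -/

import Mathlib

open Finset

namespace NoCD

/-- Messages are finite lists of natural numbers: their size is unbounded, and any finite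
amount of information can be encoded in one message. -/
abbrev Message := List ℕ

/-- What a device does in one time slot. -/
inductive SlotAction where
  | transmit (m : Message)
  | listen
  | idle

/-- What a device perceives in one time slot. Only listeners receive a signal; `nothing` is the
empty perception of transmitting and of idle devices. -/
inductive Perception where
  | nothing
  | silence
  | heard (m : Message)

/-- The final designation of a device. -/
inductive Role where
  | leader
  | follower

namespace SlotAction

/-- The message that is put on the channel, if any. -/
def sent : SlotAction → Option Message
  | transmit m => some m
  | listen => none
  | idle => none

/-- Transmitting and listening cost one unit of energy, idling is free. -/
def cost : SlotAction → ℕ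
  | transmit _ => 1
  | listen => 1
  | idle => 0

end SlotAction

/-- A deterministic algorithm. `time N` is the number of time slots used on ID space
`{0, …, N - 1}`. A device knows `N`, its own ID, and the list of its own past perceptions (most
recent first); these determine its next action and, after the last slot, its role. (The past
actions of the device are determined by the same data. Local computation is free.) -/
structure Algorithm where
  time : ℕ → ℕ
  act : (N : ℕ) → Fin N → List Perception → SlotAction
  role : (N : ℕ) → Fin N → List Perception → Role

/-- The state of the channel when the set of active devices is `S` and device `v` performs `a v`:
a message if exactly one active device transmits, and `none` if no device or at least two devices
transmit (these two cases cannot be distinguished). -/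
def channel {N : ℕ} (S : Finset (Fin N)) (a : Fin N → SlotAction) : Option Message :=
  match (S.sort (· ≤ ·)).filterMap (fun v => (a v).sent) with
  | [m] => some m
  | _ => none

/-- The perception of a device in the No-CD model, from its own action and the channel. -/
def perceive : SlotAction → Option Message → Perception
  | SlotAction.transmit _, _ => Perception.nothing
  | SlotAction.idle, _ => Perception.nothing
  | SlotAction.listen, none => Perception.silence
  | SlotAction.listen, some m => Perception.heard m

namespace Algorithm

variable (A : Algorithm) {N : ℕ} (S : Finset (Fin N))

/-- The perceptions of each device during the first `t` slots of the execution of `A` in which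
the set of active devices is `S`. -/
def history : ℕ → Fin N → List Perception
  | 0 => fun _ => []
  | t + 1 => fun v =>
      perceive (A.act N v (history t v)) (channel S (fun w => A.act N w (history t w)))
        :: history t v

/-- The action of device `v` in slot `t` (slots are numbered from `0`). -/
def action (t : ℕ) (v : Fin N) : SlotAction :=
  A.act N v (A.history S t v)

/-- The designation of device `v` at the end of the execution. -/
def finalRole (v : Fin N) : Role :=
  A.role N v (A.history S (A.time N) v)

/-- The energy spent by device `v`: the number of slots in which it transmits or listens. -/
def energy (v : Fin N) : ℕ :=
  ∑ t ∈ range (A.time N), (A.action S t v).cost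

/-- In slot `t` device `v` transmits the message `m` and every other active device listens. -/
def Announces (t : ℕ) (v : Fin N) (m : Message) : Prop :=
  A.action S t v = SlotAction.transmit m ∧ ∀ w ∈ S, w ≠ v → A.action S t w = SlotAction.listen

/-- Leader Election: exactly one active device designates itself the leader, all others designate
themselves followers, and in the last slot of the computation the leader transmits a message
while every follower listens. -/
def SolvesLeaderElection : Prop :=
  ∃ v ∈ S, A.finalRole S v = Role.leader ∧
    (∀ w ∈ S, w ≠ v → A.finalRole S w = Role.follower) ∧
    ∃ t m, A.time N = t + 1 ∧ A.Announces S t v m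

/-- Census: in the last slot of the computation some active device announces a list of the IDs of
all active devices. -/
def SolvesCensus : Prop :=
  ∃ v ∈ S, ∃ t m, A.time N = t + 1 ∧ A.Announces S t v m ∧
    m.Nodup ∧ ∀ x : ℕ, x ∈ m ↔ ∃ w ∈ S, (w : ℕ) = x

end Algorithm

/-- The inverse Ackermann function: the least `i` with `N ≤ ack i i`. -/
def inverseAck (N : ℕ) : ℕ :=
  Nat.find (p := fun i => N ≤ ack i i) ⟨N, (lt_ack_left N N).le⟩

/-- The growth function `a_i(j)`: `a_0(j) = j ^ 5`, and `a_{i+1}(j)` is the `j`-fold iterate of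
`a_i` applied to `j ^ 4`. -/
def growthA : ℕ → ℕ → ℕ
  | 0, j => j ^ 5
  | i + 1, j => (growthA i)^[j] (j ^ 4)

/-- The growth function `b_i(j)`: `b_0(j) = 2 ^ j`, and `b_{i+1}(j)` is `2 ^ j` times the product
of `b_i` over the first `j` terms of the `a_i`-orbit of `j ^ 4`. -/
def growthB : ℕ → ℕ → ℕ
  | 0, j => 2 ^ j
  | i + 1, j => 2 ^ j * ∏ r ∈ range j, growthB i ((growthA i)^[r] (j ^ 4))

end NoCD

namespace NoCD

/-! ### The growth functions -/

/-! Blocks of IDs are merged up the binary tree. At level `l` each block of length `2 ^ l` gets one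
slot, in which one awake device transmits the block's roster; the devices of the parent block that
are awake at level `l + 1` listen. Hence time is linear, and energy is about three times the number
of levels at which a device is awake.

Blocks with fewer than `2 ^ (l / 2)` devices are given up. These losses form a geometric series, so
in a dense set at least half of the required `c * N` devices survive (`card_alive_top`), and every
surviving block is large enough to share out the work. A phase of order 0 starting at level `b`
splits each block into `2 ^ e` teams, `e = b / 2 - q`, and wakes one team per level. A phase of
order `i + 1` uses such a phase to climb to much larger blocks, then splits again and gives each
team a whole phase of order `i`. Each order adds only 3 waking levels per device (`card_route_le`),
while the length of a phase climbs one row of the Ackermann function (`ack_le_finish`). Order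
`inverseAck N + 1` therefore covers all levels.

A sleeping device has an outdated roster, yet must know when to wake. Teams are formed only among
devices awake at the level of the split (`route_consistent`), so a device either knew the block when
its team was dealt or belongs to no team of that split (`Sound.mem_awake_iff`). The invariant
`Informed` rests on this.

At the top the survivors know each other. Each hears a bounded number of ID calls, the collected IDs
are passed along in rank order, and the last survivor, the leader, announces the census.

The growth estimates are independent of the algorithm: orbits of `growthA` are compared with orbits
of a row of `ack`. -/

theorem ack_succ_eq_iterate (m n : ℕ) : ack (m + 1) n = (ack m)^[n + 1] 1 := by
  induction n with
  | zero => simp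
  | succ n ih => rw [ack_succ_succ, ih, ← Function.iterate_succ_apply' (ack m)]

/-- The shift by one in `hf` is what makes the comparison survive iteration: `z + 1 ≤ y` is carried
to `ack m z + 1 ≤ f y`. The bound 32 is carried along because `ack m` exceeds its argument. -/
theorem iterate_ack_le {f : ℕ → ℕ} {m : ℕ} (hf : ∀ x, 32 < x → ack m (x - 1) + 1 ≤ f x)
    {y : ℕ} (hy : 32 < y) (r : ℕ) :
    (ack m)^[r] 1 + 1 ≤ f^[r] y ∧ 32 < f^[r] y := by
  induction r with
  | zero => simp; omega
  | succ r ih =>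
    rw [Function.iterate_succ_apply', Function.iterate_succ_apply']
    have h := hf _ ih.2
    have h1 : (ack m)^[r] 1 ≤ f^[r] y - 1 := by omega
    have h2 := ack_le_ack (le_refl m) h1
    have h3 := lt_ack_right m (f^[r] y - 1)
    omega

theorem ack_one_eq (n : ℕ) : ack 1 n = n + 2 := by
  simp

theorem lt_pow_four {j : ℕ} (hj : 32 < j) : 32 < j ^ 4 :=
  hj.trans_le (Nat.le_self_pow (by norm_num) j)

/-- Row `i + 1` at `j - 1`, rather than row `i` at `j`, makes the induction close: `ack (i + 2) (j -
1)` is exactly `j` iterations of `ack (i + 1)`, matching the `j` iterations in `growthA`. -/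
theorem ack_lt_growthA (i : ℕ) : ∀ j, 32 < j → ack (i + 1) (j - 1) + 1 ≤ growthA i j := by
  induction i with
  | zero =>
    intro j hj
    have h : j * 33 ≤ j ^ 5 := by
      calc j * 33 ≤ j * j ^ 4 := Nat.mul_le_mul_left _ (lt_pow_four hj)
        _ = j ^ 5 := by ring
    simp only [growthA, zero_add, ack_one_eq]
    omega
  | succ i ih =>
    intro j hj
    have h := (iterate_ack_le ih (lt_pow_four hj) j).1
    rw [ack_succ_eq_iterate, Nat.sub_add_cancel (by omega)]
    exact h

theorem one_le_growthB (i : ℕ) : ∀ j, 1 ≤ growthB i j := by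
  induction i with
  | zero => exact fun j => Nat.one_le_two_pow
  | succ i ih =>
    exact fun j => Nat.mul_pos Nat.one_le_two_pow (Finset.prod_pos fun r _ => ih _)

theorem ack_le_growthB (i : ℕ) : ∀ j, 32 < j → ack (i + 1) (j - 1) ≤ growthB i j := by
  induction i with
  | zero =>
    intro j hj
    have := Nat.lt_two_pow_self (n := j)
    simp only [growthB, zero_add, ack_one_eq]
    omega
  | succ i ih =>
    intro j hj
    obtain ⟨k, rfl⟩ : ∃ k, j = k + 1 := ⟨j - 1, by omega⟩
    have h := iterate_ack_le (ack_lt_growthA i) (lt_pow_four hj) k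
    have h1 := ih _ h.2
    -- The last factor of the product alone suffices: its argument dominates `k` iterations, and
    -- `growthB i` supplies one more.
    have h2 : (ack (i + 1))^[k + 1] 1 ≤ growthB i ((growthA i)^[k] ((k + 1) ^ 4)) := by
      rw [Function.iterate_succ_apply']
      exact (ack_le_ack le_rfl (by omega)).trans h1
    rw [ack_succ_eq_iterate, Nat.add_sub_cancel]
    refine h2.trans ?_
    have h3 : growthB i ((growthA i)^[k] ((k + 1) ^ 4)) ≤
        ∏ r ∈ range (k + 1), growthB i ((growthA i)^[r] ((k + 1) ^ 4)) :=
      Finset.single_le_prod' (f := fun r => growthB i ((growthA i)^[r] ((k + 1) ^ 4)))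
        (fun r _ => one_le_growthB i _) (by simp)
    exact h3.trans (Nat.le_mul_of_pos_left _ (by positivity))

theorem ack_le_growth (i j : ℕ) (hj : 32 < j) :
    ack i j ≤ growthA i j ∧ ack i j ≤ growthB i j := by
  obtain ⟨k, rfl⟩ : ∃ k, j = k + 1 := ⟨j - 1, by omega⟩
  have h := ack_succ_right_le_ack_succ_left (m := i) (n := k)
  have ha := ack_lt_growthA i _ hj
  have hb := ack_le_growthB i _ hj
  rw [Nat.add_sub_cancel] at ha hb
  omega

/-! ### Aligned blocks of IDs and the splitting of device sets into teams -/

/-- The members of `X` in the same aligned block of length `2 ^ l` as `v`. -/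
def cell (l v : ℕ) (X : Finset ℕ) : Finset ℕ :=
  X.filter fun w => w / 2 ^ l = v / 2 ^ l

theorem mem_cell {l v w : ℕ} {X : Finset ℕ} :
    w ∈ cell l v X ↔ w ∈ X ∧ w / 2 ^ l = v / 2 ^ l := by
  simp [cell]

theorem mem_cell_self {l v : ℕ} {X : Finset ℕ} : v ∈ cell l v X ↔ v ∈ X := by
  simp [cell]

theorem block_eq_of_le {k l v w : ℕ} (h : k ≤ l) (hw : w / 2 ^ k = v / 2 ^ k) :
    w / 2 ^ l = v / 2 ^ l := by
  obtain ⟨d, rfl⟩ := Nat.exists_eq_add_of_le h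
  rw [pow_add, ← Nat.div_div_eq_div_mul, ← Nat.div_div_eq_div_mul, hw]

theorem cell_congr {l v w : ℕ} (h : w / 2 ^ l = v / 2 ^ l) (X : Finset ℕ) :
    cell l w X = cell l v X := by
  simp [cell, h]

theorem cell_cell {k l : ℕ} (h : k ≤ l) (v : ℕ) (X : Finset ℕ) :
    cell k v (cell l v X) = cell k v X := by
  ext w
  simp only [mem_cell]
  exact ⟨fun hw => ⟨hw.1.1, hw.2⟩, fun hw => ⟨⟨hw.1, block_eq_of_le h hw.2⟩, hw.2⟩⟩

theorem cell_eq_of_le {k l v : ℕ} {X Y : Finset ℕ} (h : k ≤ l) (hXY : cell l v X = cell l v Y) :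
    cell k v X = cell k v Y := by
  rw [← cell_cell h v X, hXY, cell_cell h]

/-- The number of elements of `P` that precede `v`. -/
def rank (P : Finset ℕ) (v : ℕ) : ℕ :=
  (P.filter fun w => w < v).card

theorem rank_lt_rank {P : Finset ℕ} {v w : ℕ} (hv : v ∈ P) (h : v < w) : rank P v < rank P w := by
  refine card_lt_card ⟨fun x hx => ?_, fun hs => ?_⟩
  · rw [mem_filter] at hx ⊢
    exact ⟨hx.1, hx.2.trans h⟩
  · have := hs (mem_filter.2 ⟨hv, h⟩)
    simp at this

theorem rank_injOn (P : Finset ℕ) : Set.InjOn (rank P) P := by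
  intro v hv w hw h
  rcases lt_trichotomy v w with h1 | h1 | h1
  · exact absurd h (rank_lt_rank hv h1).ne
  · exact h1
  · exact absurd h (rank_lt_rank hw h1).ne'

theorem rank_lt_card {P : Finset ℕ} {v : ℕ} (hv : v ∈ P) : rank P v < P.card := by
  refine card_lt_card ⟨filter_subset _ _, fun hs => ?_⟩
  have := hs hv
  simp at this

theorem image_rank (P : Finset ℕ) : P.image (rank P) = range P.card := by
  refine eq_of_subset_of_card_le (fun x hx => ?_) ?_
  · obtain ⟨v, hv, rfl⟩ := mem_image.1 hx
    exact mem_range.2 (rank_lt_card hv)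
  · rw [card_range, card_image_of_injOn (rank_injOn P)]

theorem exists_rank_eq {P : Finset ℕ} {r : ℕ} (h : r < P.card) : ∃ v ∈ P, rank P v = r := by
  have := image_rank P ▸ mem_range.2 h
  simpa using this

/-- Ranks in `P` fill `range P.card`, which contains `j * T + r` for every `j < P.card / T`. -/
theorem div_le_card_rank_mod (P : Finset ℕ) {T r : ℕ} (hr : r < T) :
    P.card / T ≤ (P.filter fun v => rank P v % T = r).card := by
  have h : ∀ j ∈ range (P.card / T), j * T + r < P.card := by
    intro j hj
    rw [mem_range] at hj
    calc j * T + r < (j + 1) * T := by rw [add_mul]; omega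
      _ ≤ P.card / T * T := Nat.mul_le_mul_right _ hj
      _ ≤ P.card := Nat.div_mul_le_self _ _
  have h2 : (range (P.card / T)).image (fun j => j * T + r) ⊆
      (P.filter fun v => rank P v % T = r).image (rank P) := by
    intro x hx
    obtain ⟨j, hj, rfl⟩ := mem_image.1 hx
    obtain ⟨v, hv, hvr⟩ := exists_rank_eq (h j hj)
    refine mem_image.2 ⟨v, mem_filter.2 ⟨hv, ?_⟩, hvr⟩
    rw [hvr, Nat.mul_comm, Nat.mul_add_mod, Nat.mod_eq_of_lt hr]
  have h3 := (card_le_card h2).trans card_image_le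
  rwa [card_image_of_injective, card_range] at h3
  intro a b hab
  have hT : 0 < T := by omega
  simpa [hT.ne'] using hab

/-- A splitting instruction `(b, T, r)`: inside every block of level `b` the devices are dealt
into `T` teams according to their rank, and team `r` is selected. -/
abbrev Split := ℕ × ℕ × ℕ

/-- The members of `P` that are selected by a splitting instruction. -/
def split (s : Split) (P : Finset ℕ) : Finset ℕ :=
  P.filter fun v => rank (cell s.1 v P) v % s.2.1 = s.2.2

/-- The members of `P` that are selected by a list of splitting instructions. -/
def team (p : List Split) (P : Finset ℕ) : Finset ℕ :=
  p.foldl (fun Q s => split s Q) P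

theorem split_subset (s : Split) (P : Finset ℕ) : split s P ⊆ P :=
  filter_subset _ _

@[simp] theorem team_nil (P : Finset ℕ) : team [] P = P := rfl

@[simp] theorem team_cons (s : Split) (p : List Split) (P : Finset ℕ) :
    team (s :: p) P = team p (split s P) := rfl

theorem team_append (p p' : List Split) (P : Finset ℕ) :
    team (p ++ p') P = team p' (team p P) := by
  simp [team]

theorem team_subset (p : List Split) (P : Finset ℕ) : team p P ⊆ P := by
  induction p generalizing P with
  | nil => simp
  | cons s p ih => exact (ih _).trans (split_subset s P)

theorem cell_split {s : Split} {k : ℕ} (h : s.1 ≤ k) (v : ℕ) (P : Finset ℕ) :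
    cell k v (split s P) = split s (cell k v P) := by
  ext w
  simp only [mem_cell, split, mem_filter]
  have key : w / 2 ^ k = v / 2 ^ k → cell s.1 w (cell k v P) = cell s.1 w P := by
    intro hw
    rw [← cell_congr hw, cell_cell h]
  constructor
  · rintro ⟨⟨h1, h2⟩, h3⟩
    exact ⟨⟨h1, h3⟩, by rw [key h3, h2]⟩
  · rintro ⟨⟨h1, h3⟩, h2⟩
    exact ⟨⟨h1, by rw [← key h3, h2]⟩, h3⟩

theorem cell_team {p : List Split} {k : ℕ} (h : ∀ s ∈ p, s.1 ≤ k) (v : ℕ) (P : Finset ℕ) :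
    cell k v (team p P) = team p (cell k v P) := by
  induction p generalizing P with
  | nil => rfl
  | cons s p ih =>
    rw [team_cons, team_cons, ih (fun s' hs' => h s' (by simp [hs'])), cell_split (h s (by simp))]

/-- Locality: instructions up to level `k` look only inside blocks of level `k`, so a roster of such
a block decides membership. -/
theorem mem_team_congr {p : List Split} {k v : ℕ} {X Y : Finset ℕ} (h : ∀ s ∈ p, s.1 ≤ k)
    (hXY : cell k v X = cell k v Y) : v ∈ team p X ↔ v ∈ team p Y := by
  rw [← mem_cell_self (l := k), cell_team h, hXY, ← cell_team h, mem_cell_self]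

/-! ### Density of device sets -/

/-- `P` contains at least a `2 ^ (-q)` fraction of `X` in each block of level `b`. -/
def Frac (b q : ℕ) (P X : Finset ℕ) : Prop :=
  ∀ v ∈ X, (cell b v X).card ≤ 2 ^ q * (cell b v P).card

/-- A larger block is a disjoint union of blocks of level `b`; the inequalities are summed over
these. -/
theorem Frac.mono {b b' q : ℕ} {P X : Finset ℕ} (h : Frac b q P X) (hP : P ⊆ X) (hb : b ≤ b') :
    Frac b' q P X := by
  intro v _
  have key : ∀ t : ℕ, ((cell b' v X).filter fun w => w / 2 ^ b = t).card ≤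
      2 ^ q * ((cell b' v P).filter fun w => w / 2 ^ b = t).card := by
    intro t
    rcases ((cell b' v X).filter fun w => w / 2 ^ b = t).eq_empty_or_nonempty with h0 | ⟨w, hw⟩
    · simp [h0]
    · rw [mem_filter, mem_cell] at hw
      obtain ⟨⟨hwX, hwv⟩, rfl⟩ := hw
      have e : ∀ Y : Finset ℕ, ((cell b' v Y).filter fun u => u / 2 ^ b = w / 2 ^ b) =
          cell b w Y := by
        intro Y
        rw [← cell_congr hwv, ← cell_cell hb w Y]
        rfl
      rw [e, e]
      exact h w hwX
  set I := (cell b' v X).image (fun w => w / 2 ^ b) with hI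
  have e : ∀ Y : Finset ℕ, Y ⊆ cell b' v X →
      Y.card = ∑ t ∈ I, (Y.filter fun w => w / 2 ^ b = t).card := fun Y hY =>
    card_eq_sum_card_fiberwise fun w hw => mem_image_of_mem _ (hY hw)
  rw [e _ subset_rfl, e (cell b' v P) (filter_subset_filter _ hP), mul_sum]
  exact sum_le_sum fun t _ => key t

/-- Dealing into `2 ^ t` teams costs `t` in the exponent, and rounding down costs a further factor 2
because every team gets at least one device. -/
theorem Frac.split {b q t r : ℕ} {P X : Finset ℕ} (h : Frac b q P X)
    (hT : ∀ v ∈ X, 2 ^ t ≤ (cell b v P).card) (hr : r < 2 ^ t) :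
    Frac b (q + t + 1) (split (b, 2 ^ t, r) P) X := by
  intro v hv
  have e : cell b v (NoCD.split (b, 2 ^ t, r) P) =
      (cell b v P).filter fun w => rank (cell b v P) w % 2 ^ t = r := by
    rw [cell_split (s := (b, 2 ^ t, r)) le_rfl]
    refine filter_congr fun w hw => ?_
    rw [cell_congr (mem_cell.1 hw).2, cell_cell le_rfl]
  have h1 := div_le_card_rank_mod (cell b v P) hr
  rw [← e] at h1
  have h2 : 1 ≤ (cell b v P).card / 2 ^ t := Nat.div_pos (hT v hv) (by positivity)
  have h3 : (cell b v P).card < 2 ^ t * ((cell b v P).card / 2 ^ t + 1) :=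
    Nat.lt_mul_div_succ _ (by positivity)
  calc (cell b v X).card ≤ 2 ^ q * (cell b v P).card := h v hv
    _ ≤ 2 ^ q * (2 ^ t * (2 * ((cell b v P).card / 2 ^ t))) := by
        gcongr
        exact h3.le.trans (Nat.mul_le_mul_left _ (by omega))
    _ ≤ 2 ^ q * (2 ^ t * (2 * (cell b v (NoCD.split (b, 2 ^ t, r) P)).card)) := by gcongr
    _ = _ := by ring

/-! ### The wake-up schedule

A phase of order `0` starting at level `b` deals the devices into teams and wakes one team per
level. A phase of order `i + 1` performs a phase of order `0`, wakes everybody once, deals the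
devices into teams, and lets these perform phases of order `i` one after the other. -/

/-- The level at which the `r`-th subphase of a phase of order `i + 1` starts, where `f` maps the
first level of a subphase to its last level. -/
def stage (f : ℕ → ℕ) (b e r : ℕ) : ℕ :=
  f^[r] (b + 2 ^ e + 1)

/-- The level at which a phase of order `i` ends, if it starts at level `b` with a
`2 ^ (-q)` fraction of the devices. -/
def finish : ℕ → ℕ → ℕ → ℕ
  | 0, b, q => b + 2 ^ (b / 2 - q)
  | i + 1, b, q => stage (fun c => finish i c (q + (b / 2 - q) + 1)) b (b / 2 - q) (2 ^ (b / 2 - q))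

/-- The splitting instructions that select the devices that are awake at level `l`, during a phase
of order `0` with `2 ^ e` teams that starts at level `b`. -/
def baseRoute (b e l : ℕ) : List Split :=
  if l = b then [] else [(b, 2 ^ e, l - b)]

/-- The splitting instructions that select the devices that are awake at level `l`, during a phase
of order `i` that starts at level `b` with a `2 ^ (-q)` fraction of the devices. -/
def route : ℕ → ℕ → ℕ → ℕ → List Split
  | 0, b, q, l => baseRoute b (b / 2 - q) l
  | i + 1, b, q, l =>
    let e := b / 2 - q
    let g := stage (fun c => finish i c (q + e + 1)) b e
    let r := Nat.findGreatest (fun r => g r ≤ l) (2 ^ e)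
    if l < b + 2 ^ e then baseRoute b e l
    else if l = b + 2 ^ e then []
    else (b + 2 ^ e, 2 ^ e, r) :: route i (g r) (q + e + 1) l

theorem stage_succ (f : ℕ → ℕ) (b e r : ℕ) : stage f b e (r + 1) = f (stage f b e r) :=
  Function.iterate_succ_apply' f r _

theorem stage_strictMono {f : ℕ → ℕ} (hf : ∀ c, c < f c) (b e : ℕ) : StrictMono (stage f b e) :=
  strictMono_nat_of_lt_succ fun r => by rw [stage_succ]; exact hf _

theorem lt_stage {f : ℕ → ℕ} (hf : ∀ c, c < f c) (b e r : ℕ) : b + 2 ^ e < stage f b e r :=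
  lt_of_lt_of_le (Nat.lt_succ_self _) ((stage_strictMono hf b e).monotone (Nat.zero_le r))

theorem lt_finish (i : ℕ) : ∀ b q, b < finish i b q := by
  induction i with
  | zero => exact fun b q => Nat.lt_add_of_pos_right (by positivity)
  | succ i ih =>
    exact fun b q => (Nat.le_add_right _ _).trans_lt (lt_stage (fun c => ih c _) _ _ _)

/-- Where a level lies inside a phase of order `i + 1`. -/
theorem route_cases (i b q l : ℕ) (hl : l < finish (i + 1) b q) :
    let e := b / 2 - q
    let g := stage (fun c => finish i c (q + e + 1)) b e
    (l < b + 2 ^ e ∧ route (i + 1) b q l = baseRoute b e l) ∨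
    (l = b + 2 ^ e ∧ route (i + 1) b q l = []) ∨
    ∃ r < 2 ^ e, g r ≤ l ∧ l < finish i (g r) (q + e + 1) ∧ g (r + 1) ≤ finish (i + 1) b q ∧
      ∀ m, g r ≤ m → m ≤ l →
        route (i + 1) b q m = (b + 2 ^ e, 2 ^ e, r) :: route i (g r) (q + e + 1) m := by
  intro e g
  have hg : StrictMono g := stage_strictMono (fun c => lt_finish i c _) b e
  have hg0 : ∀ r, b + 2 ^ e < g r := lt_stage (fun c => lt_finish i c _) b e
  have hfin : finish (i + 1) b q = g (2 ^ e) := rfl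
  rcases lt_trichotomy l (b + 2 ^ e) with h | h | h
  · refine Or.inl ⟨h, ?_⟩
    simp only [route]
    rw [if_pos h]
  · refine Or.inr (Or.inl ⟨h, ?_⟩)
    simp only [route]
    rw [if_neg h.not_lt, if_pos h]
  · refine Or.inr (Or.inr ?_)
    have h0 : g 0 ≤ l := h
    set r := Nat.findGreatest (fun r => g r ≤ l) (2 ^ e) with hr
    have h1 : g r ≤ l := Nat.findGreatest_spec (P := fun r => g r ≤ l) (Nat.zero_le _) h0
    have h2 : r < 2 ^ e := hg.lt_iff_lt.1 (h1.trans_lt hl)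
    have h3 : l < g (r + 1) := by
      by_contra hcon
      have := Nat.le_findGreatest (P := fun r => g r ≤ l) (show r + 1 ≤ 2 ^ e from h2)
        (not_lt.1 hcon)
      omega
    refine ⟨r, h2, h1, ?_, ?_, ?_⟩
    · exact h3.trans_eq (stage_succ _ b e r)
    · rw [hfin]
      exact hg.monotone h2
    -- Earlier levels of the same subphase share the same head instruction; `route_consistent` needs
    -- this when it looks back from `l` to the level of a split.
    · intro m hm hml
      have h4 : b + 2 ^ e < m := (hg0 r).trans_le hm
      have h5 : Nat.findGreatest (fun r => g r ≤ m) (2 ^ e) = r := by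
        rw [Nat.findGreatest_eq_iff]
        refine ⟨h2.le, fun _ => hm, fun n hn _ hnm => ?_⟩
        exact absurd (hml.trans_lt h3) (not_lt.2 ((hg.monotone hn).trans hnm))
      simp only [route]
      rw [if_neg h4.not_gt, if_neg h4.ne']
      change (_, _, Nat.findGreatest (fun r => g r ≤ m) (2 ^ e)) ::
        route i (g (Nat.findGreatest (fun r => g r ≤ m) (2 ^ e))) _ m = _
      rw [h5]

theorem baseRoute_consistent {b e l : ℕ} (hb : b ≤ l) {p p' : List Split} {s : Split}
    (h : baseRoute b e l = p ++ s :: p') : s.1 = b ∧ b < l ∧ p = [] := by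
  unfold baseRoute at h
  split_ifs at h with h1
  · simp at h
  · rcases p with _ | ⟨a, p⟩
    · simp only [List.nil_append, List.cons.injEq] at h
      exact ⟨by rw [← h.1], by omega, rfl⟩
    · simp at h

/-- The teams of an instruction at level `s.1` are formed by devices that are awake at this
level. -/
theorem route_consistent (i : ℕ) : ∀ b q l, b ≤ l → l < finish i b q →
    ∀ (p p' : List Split) (s : Split), route i b q l = p ++ s :: p' →
      b ≤ s.1 ∧ s.1 < l ∧ route i b q s.1 = p := by
  induction i with
  | zero =>
    intro b q l hb hl p p' s h
    obtain ⟨h1, h2, h3⟩ := baseRoute_consistent hb h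
    rw [h1, h3]
    exact ⟨le_rfl, h2, by simp [route, baseRoute]⟩
  | succ i ih =>
    intro b q l hb hl p p' s h
    -- The two levels at which this phase itself deals teams are levels at which all its devices are
    -- awake.
    have hb0 : route (i + 1) b q b = [] := by
      simp [route, baseRoute]
    have hb1 : route (i + 1) b q (b + 2 ^ (b / 2 - q)) = [] := by
      simp [route]
    rcases route_cases i b q l hl with ⟨h1, h2⟩ | ⟨h1, h2⟩ | ⟨r, hr, h1, h2, h3, h4⟩
    · rw [h2] at h
      obtain ⟨h1, h2, h3⟩ := baseRoute_consistent hb h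
      rw [h1, h3]
      exact ⟨le_rfl, h2, hb0⟩
    · rw [h2] at h
      simp at h
    · have hg0 := lt_stage (fun c => lt_finish i c (q + (b / 2 - q) + 1)) b (b / 2 - q) r
      rw [h4 l h1 le_rfl] at h
      rcases p with _ | ⟨a, p⟩
      · simp only [List.nil_append, List.cons.injEq] at h
        rw [← h.1]
        exact ⟨Nat.le_add_right _ _, hg0.trans_le h1, hb1⟩
      · simp only [List.cons_append, List.cons.injEq] at h
        obtain ⟨h5, h6, h7⟩ := ih _ _ l h1 h2 p p' s h.2
        refine ⟨by omega, h6, ?_⟩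
        rw [h4 s.1 h5 h6.le, h.1, h7]

/-- A device is awake only at level `b`, with everybody, and at the level of its own team. -/
theorem card_baseRoute_le (b e : ℕ) (P : Finset ℕ) (v : ℕ) :
    ((Ico b (b + 2 ^ e)).filter fun l => v ∈ team (baseRoute b e l) P).card ≤ 2 := by
  refine (card_le_card (t := {b, b + rank (cell b v P) v % 2 ^ e}) fun l hl => ?_).trans
    card_le_two
  simp only [mem_filter, mem_Ico] at hl
  obtain ⟨⟨h1, h2⟩, h3⟩ := hl
  unfold baseRoute at h3
  split_ifs at h3 with h4
  · simp [h4]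
  · simp only [team_cons, team_nil, split, mem_filter] at h3
    simp only [mem_insert, mem_singleton]
    omega

/-- Every device is awake rarely. -/
theorem card_route_le (i : ℕ) : ∀ b q P v,
    ((Ico b (finish i b q)).filter fun l => v ∈ team (route i b q l) P).card ≤ 3 * i + 2 := by
  induction i with
  | zero => exact fun b q P v => card_baseRoute_le b _ P v
  | succ i ih =>
    intro b q P v
    set e := b / 2 - q with he
    set g := stage (fun c => finish i c (q + e + 1)) b e with hg
    -- The team of `v` is fixed by one split, so only subphase `r` can wake it. The count is 2 for
    -- the base phase, 1 for level `b + 2 ^ e`, and the induction hypothesis.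
    set r := rank (cell (b + 2 ^ e) v P) v % 2 ^ e with hr
    set A := (Ico b (b + 2 ^ e)).filter fun l => v ∈ team (baseRoute b e l) P with hA
    set B := (Ico (g r) (finish i (g r) (q + e + 1))).filter
      fun l => v ∈ team (route i (g r) (q + e + 1) l) (split (b + 2 ^ e, 2 ^ e, r) P) with hB
    have hsub : ((Ico b (finish (i + 1) b q)).filter fun l => v ∈ team (route (i + 1) b q l) P) ⊆
        A ∪ ({b + 2 ^ e} ∪ B) := by
      intro l hl
      simp only [mem_filter, mem_Ico] at hl
      obtain ⟨⟨h1, h2⟩, h3⟩ := hl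
      simp only [mem_union, mem_singleton]
      rcases route_cases i b q l h2 with ⟨h4, h5⟩ | ⟨h4, h5⟩ | ⟨r', hr', h4, h5, h6, h7⟩
      · rw [h5] at h3
        exact Or.inl (mem_filter.2 ⟨mem_Ico.2 ⟨h1, h4⟩, h3⟩)
      · exact Or.inr (Or.inl h4)
      · rw [h7 l h4 le_rfl, team_cons] at h3
        have hmem := team_subset _ _ h3
        simp only [split, mem_filter] at hmem
        obtain rfl : r = r' := hmem.2
        exact Or.inr (Or.inr (by simp only [hB, mem_filter, mem_Ico]; exact ⟨⟨h4, h5⟩, h3⟩))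
    have h1 := card_le_card hsub
    have h2 := card_union_le A ({b + 2 ^ e} ∪ B)
    have h3 := card_union_le {b + 2 ^ e} B
    have h4 : A.card ≤ 2 := card_baseRoute_le b e P v
    have h5 : B.card ≤ 3 * i + 2 := ih _ _ _ _
    rw [card_singleton] at h3
    omega

/-- Every nonempty block of level `k` contains at least `2 ^ (k / 2)` devices, for `k ≤ L`. -/
def Thick (b₀ L : ℕ) (X : Finset ℕ) : Prop :=
  ∀ k, b₀ ≤ k → k ≤ L → ∀ v ∈ X, 2 ^ (k / 2) ≤ (cell k v X).card

/-- The factor `2 ^ q` lost to density is cancelled from the thickness bound `2 ^ (b / 2)`. If `q`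
exceeds `b / 2`, truncated subtraction leaves only the claim that the block meets `P`. -/
theorem two_pow_sub_le {b₀ b q L : ℕ} {P X : Finset ℕ} (hX : Thick b₀ L X) (hF : Frac b q P X)
    (hb : b₀ ≤ b) (hL : b ≤ L) {v : ℕ} (hv : v ∈ X) : 2 ^ (b / 2 - q) ≤ (cell b v P).card := by
  have h := (hX b hb hL v hv).trans (hF v hv)
  by_cases hq : q ≤ b / 2
  · obtain ⟨d, hd⟩ := Nat.exists_eq_add_of_le hq
    rw [hd, Nat.add_sub_cancel_left]
    rw [hd, pow_add] at h
    exact Nat.le_of_mul_le_mul_left h (by positivity)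
  · rw [Nat.sub_eq_zero_of_le (by omega), pow_zero]
    rcases Nat.eq_zero_or_pos (cell b v P).card with h0 | h0
    · rw [h0, mul_zero] at h
      exact absurd h (by simp)
    · exact h0

theorem exists_mem_of_frac {b₀ b q l L : ℕ} {P X : Finset ℕ} (hX : Thick b₀ L X)
    (hF : Frac b q P X) (hb : b₀ ≤ b) (hl : b ≤ l) (hL : b ≤ L) {v : ℕ} (hv : v ∈ X) :
    ∃ w ∈ P, w / 2 ^ l = v / 2 ^ l := by
  have h := (Nat.one_le_two_pow).trans (two_pow_sub_le hX hF hb hL hv)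
  obtain ⟨w, hw⟩ := card_pos.1 h
  rw [mem_cell] at hw
  exact ⟨w, hw.1, block_eq_of_le hl hw.2⟩

theorem exists_awake_base {b₀ b q l L : ℕ} {P X : Finset ℕ} (hX : Thick b₀ L X)
    (hF : Frac b q P X) (hb : b₀ ≤ b) (hl : b ≤ l) (hl' : l < b + 2 ^ (b / 2 - q)) (hL : l ≤ L)
    {v : ℕ} (hv : v ∈ X) :
    ∃ w ∈ team (baseRoute b (b / 2 - q) l) P, w / 2 ^ l = v / 2 ^ l := by
  unfold baseRoute
  split_ifs with h
  · exact exists_mem_of_frac hX hF hb hl (hl.trans hL) hv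
  · exact exists_mem_of_frac hX (hF.split (fun u hu => two_pow_sub_le hX hF hb (hl.trans hL) hu)
      (by omega)) hb hl (hl.trans hL) hv

/-- In every nonempty block some device is awake. -/
theorem exists_awake {b₀ L : ℕ} {X : Finset ℕ} (hX : Thick b₀ L X) (i : ℕ) : ∀ b q P l,
    P ⊆ X → Frac b q P X → b₀ ≤ b → b ≤ l → l < finish i b q → l ≤ L → ∀ v ∈ X,
      ∃ w ∈ team (route i b q l) P, w / 2 ^ l = v / 2 ^ l := by
  induction i with
  | zero =>
    exact fun b q P l _ hF hb hl hl' hL v hv => exists_awake_base hX hF hb hl hl' hL hv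
  | succ i ih =>
    intro b q P l hP hF hb hl hl' hL v hv
    rcases route_cases i b q l hl' with ⟨h4, h5⟩ | ⟨h4, h5⟩ | ⟨r, hr, h4, h5, h6, h7⟩
    · rw [h5]
      exact exists_awake_base hX hF hb hl h4 hL hv
    · rw [h5]
      exact exists_mem_of_frac hX hF hb hl (hl.trans hL) hv
    · rw [h7 l h4 le_rfl, team_cons]
      have hg0 := lt_stage (fun c => lt_finish i c (q + (b / 2 - q) + 1)) b (b / 2 - q) r
      have hb1 : b ≤ b + 2 ^ (b / 2 - q) := Nat.le_add_right _ _
      -- Density passes to the larger blocks of level `b + 2 ^ e`, which contain more than enough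
      -- devices for `2 ^ e` teams.
      have hF1 : Frac (b + 2 ^ (b / 2 - q)) q P X := hF.mono hP hb1
      have hF2 : Frac (b + 2 ^ (b / 2 - q)) (q + (b / 2 - q) + 1)
          (split (b + 2 ^ (b / 2 - q), 2 ^ (b / 2 - q), r) P) X := by
        refine hF1.split (fun u hu => le_trans ?_ (two_pow_sub_le hX hF1 (hb.trans hb1)
          (by omega) hu)) hr
        exact Nat.pow_le_pow_right (by norm_num) (by omega)
      have hP2 := (split_subset (b + 2 ^ (b / 2 - q), 2 ^ (b / 2 - q), r) P).trans hP
      exact ih _ _ _ l hP2 (hF2.mono hP2 hg0.le) (by omega) h4 h5 hL v hv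

/-- Phases of order `i` are as long as the `i`-th row of the Ackermann function. -/
theorem ack_le_finish (i : ℕ) : ∀ b q, 4 ≤ b / 2 - q →
    ack i (b / 2 - q) ≤ finish i b q / 2 - q := by
  induction i with
  | zero =>
    intro b q h
    obtain ⟨d, hd⟩ : ∃ d, b / 2 - q = d + 1 := ⟨b / 2 - q - 1, by omega⟩
    have h2 : 2 ^ (b / 2 - q) = 2 * 2 ^ d := by rw [hd, pow_succ']
    have h3 : 0 < 2 ^ d := by positivity
    simp only [finish, ack_zero]
    rw [h2]
    omega
  | succ i ih =>
    intro b q h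
    set e := b / 2 - q with he
    have key : ∀ r, (ack i)^[r] 1 ≤ stage (fun c => finish i c (q + e + 1)) b e r / 2 - (q + e + 1)
        ∧ 4 ≤ stage (fun c => finish i c (q + e + 1)) b e r / 2 - (q + e + 1) := by
      intro r
      induction r with
      | zero =>
        -- The base phase pays for the density loss `e + 1`: the first subphase starts with exponent
        -- at least `2 ^ (e - 1) - 1`, which is at least 4 since `4 ≤ e`.
        obtain ⟨d, hd⟩ : ∃ d, e = d + 4 := ⟨e - 4, by omega⟩
        have h2 : 2 ^ e = 16 * 2 ^ d := by rw [hd, pow_add]; ring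
        have h3 := Nat.lt_two_pow_self (n := d)
        simp only [stage, Function.iterate_zero, id]
        rw [h2]
        omega
      | succ r ihr =>
        rw [stage_succ, Function.iterate_succ_apply']
        have h1 := ih _ _ ihr.2
        have h2 := ack_le_ack (le_refl i) ihr.1
        have h3 := lt_ack_right i (stage (fun c => finish i c (q + e + 1)) b e r / 2 - (q + e + 1))
        exact ⟨h2.trans h1, by omega⟩
    have h1 := (key (2 ^ e)).1
    -- Of the `2 ^ e` subphases, `e + 1` already give the next Ackermann row.
    have h2 : (ack i)^[e + 1] 1 ≤ (ack i)^[2 ^ e] 1 := by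
      refine Function.monotone_iterate_of_id_le (fun x => (lt_ack_right i x).le) ?_ 1
      exact Nat.lt_two_pow_self
    rw [ack_succ_eq_iterate]
    change _ ≤ stage (fun c => finish i c (q + e + 1)) b e (2 ^ e) / 2 - q
    omega

/-! ### The channel -/

theorem filterMap_eq_singleton {α β : Type*} {f : α → Option β} {l : List α} {v : α} {m : β}
    (hl : l.Nodup) (hv : v ∈ l) (hm : f v = some m) (h : ∀ w ∈ l, w ≠ v → f w = none) :
    l.filterMap f = [m] := by
  obtain ⟨s, t, rfl⟩ := List.append_of_mem hv
  rw [List.nodup_append] at hl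
  have hs : s.filterMap f = [] := List.filterMap_eq_nil_iff.2 fun w hw =>
    h w (by simp [hw]) (hl.2.2 w hw v (by simp))
  have ht : t.filterMap f = [] := List.filterMap_eq_nil_iff.2 fun w hw =>
    h w (by simp [hw]) (by rintro rfl; exact (List.nodup_cons.1 hl.2.1).1 hw)
  rw [List.filterMap_append, hs, List.filterMap_cons_some hm, ht, List.nil_append]

section Channel

variable {N : ℕ} {S : Finset (Fin N)} {a : Fin N → SlotAction}

theorem channel_eq_some {v : Fin N} {m : Message} (hv : v ∈ S) (hm : (a v).sent = some m)
    (h : ∀ w ∈ S, w ≠ v → (a w).sent = none) : channel S a = some m := by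
  unfold channel
  rw [filterMap_eq_singleton (sort_nodup _ _) ((mem_sort _).2 hv) hm
    fun w hw => h w ((mem_sort _).1 hw)]

theorem channel_eq_none (h : ∀ w ∈ S, (a w).sent = none) : channel S a = none := by
  unfold channel
  rw [List.filterMap_eq_nil_iff.2 fun w hw => h w ((mem_sort _).1 hw)]

theorem exists_of_channel {m : Message} (h : channel S a = some m) :
    ∃ v ∈ S, (a v).sent = some m := by
  unfold channel at h
  split at h
  · rename_i m' h'
    have : m' ∈ (S.sort (· ≤ ·)).filterMap fun v => (a v).sent := by simp [h']
    obtain ⟨v, hv, hm⟩ := List.mem_filterMap.1 this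
    exact ⟨v, (mem_sort _).1 hv, by rw [hm, ← h]⟩
  · exact absurd h (by simp)

end Channel

/-! ### Slot-by-slot description of algorithms -/

/-- The behaviour of a device with states in `σ` in slots that are described by elements of `D`.
The arguments of type `ℕ` are IDs. -/
structure Machine (σ D : Type) where
  init : ℕ → σ
  act : D → ℕ → σ → SlotAction
  upd : D → ℕ → σ → Perception → σ
  role : ℕ → σ → Role

namespace Machine

variable {σ D : Type} (M : Machine σ D) {N : ℕ} (S : Finset (Fin N))

/-- The state of a device, as a function of its perceptions. -/
def state (p : List D) (v : ℕ) : List Perception → σ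
  | [] => M.init v
  | x :: h =>
    match p[h.length]? with
    | some d => M.upd d v (state p v h) x
    | none => state p v h

/-- The actions of all devices in one slot. -/
def acts (d : D) (c : Fin N → σ) (v : Fin N) : SlotAction :=
  M.act d v (c v)

/-- The states after one more slot. -/
def step (d : D) (c : Fin N → σ) (v : Fin N) : σ :=
  M.upd d v (c v) (perceive (M.acts d c v) (channel S (M.acts d c)))

/-- The states after a list of slots. -/
def run (p : List D) (c : Fin N → σ) : Fin N → σ :=
  p.foldl (fun c d => M.step S d c) c

/-- The energy that a device spends in a list of slots. -/
def spent : List D → (Fin N → σ) → Fin N → ℕ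
  | [], _, _ => 0
  | d :: p, c, v => (M.acts d c v).cost + spent p (M.step S d c) v

@[simp] theorem run_nil (c : Fin N → σ) : M.run S [] c = c := rfl

@[simp] theorem run_cons (d : D) (p : List D) (c : Fin N → σ) :
    M.run S (d :: p) c = M.run S p (M.step S d c) := rfl

theorem run_append (p p' : List D) (c : Fin N → σ) :
    M.run S (p ++ p') c = M.run S p' (M.run S p c) := by
  simp [run]

theorem spent_append (p p' : List D) (c : Fin N → σ) (v : Fin N) :
    M.spent S (p ++ p') c v = M.spent S p c v + M.spent S p' (M.run S p c) v := by
  induction p generalizing c with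
  | nil => simp [spent]
  | cons d p ih => simp [spent, ih, add_assoc]

/-- `K` is preserved whatever is perceived, so energy can be bounded slot by slot without knowing
the channel; it is applied with `K` fixing the roster. -/
theorem spent_le {v : Fin N} (K : σ → Prop) (f : D → ℕ) (p : List D)
    (hK : ∀ d ∈ p, ∀ s x, K s → K (M.upd d v s x))
    (hf : ∀ d ∈ p, ∀ s, K s → (M.act d v s).cost ≤ f d) :
    ∀ c : Fin N → σ, K (c v) → M.spent S p c v ≤ (p.map f).sum := by
  induction p with
  | nil => simp [spent]
  | cons d p ih =>
    intro c hc
    have h1 := ih (fun d hd => hK d (by simp [hd])) (fun d hd => hf d (by simp [hd]))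
      (M.step S d c) (hK d (by simp) _ _ hc)
    have h2 := hf d (by simp) _ hc
    simp only [spent, List.map_cons, List.sum_cons]
    exact Nat.add_le_add h2 h1

/-- The algorithm in which the devices behave as described by a machine. -/
def toAlgorithm (M : ℕ → Machine σ D) (p : ℕ → List D) : Algorithm where
  time N := (p N).length
  act N v h :=
    match (p N)[h.length]? with
    | some d => (M N).act d v ((M N).state (p N) v h)
    | none => SlotAction.idle
  role N v h := (M N).role v ((M N).state (p N) v h)

variable (M : ℕ → Machine σ D) (p : ℕ → List D)

theorem length_history (A : Algorithm) (t : ℕ) (v : Fin N) : (A.history S t v).length = t := by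
  induction t with
  | zero => rfl
  | succ t ih => simp [Algorithm.history, ih]

/-- The states of all devices after `t` slots. -/
def config (t : ℕ) : Fin N → σ :=
  (M N).run S ((p N).take t) fun v => (M N).init v

theorem config_succ {t : ℕ} (ht : t < (p N).length) :
    config S M p (t + 1) = (M N).step S (p N)[t] (config S M p t) := by
  unfold config
  rw [List.take_succ_eq_append_getElem ht, run_append]
  rfl

theorem act_eq {t : ℕ} (ht : t < (p N).length) {v : Fin N} {h : List Perception}
    (hh : h.length = t) :
    (toAlgorithm M p).act N v h = (M N).act (p N)[t] v ((M N).state (p N) v h) := by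
  subst hh
  simp [toAlgorithm, ht]

/-- The link between the model, where actions depend on past perceptions, and the forward simulation
of states used from here on. -/
theorem state_history {t : ℕ} (ht : t ≤ (p N).length) (v : Fin N) :
    (M N).state (p N) v ((toAlgorithm M p).history S t v) = config S M p t v := by
  induction t generalizing v with
  | zero => rfl
  | succ t ih =>
    have ht' : t < (p N).length := ht
    rw [config_succ S M p ht']
    have h : ∀ w : Fin N, (toAlgorithm M p).act N w ((toAlgorithm M p).history S t w) =
        (M N).acts (p N)[t] (config S M p t) w := fun w => by
      rw [act_eq M p ht' (length_history S _ t w), ih ht'.le]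
      rfl
    simp only [Algorithm.history, state, length_history, List.getElem?_eq_getElem ht', h,
      ih ht'.le]
    rfl

theorem action_eq {t : ℕ} (ht : t < (p N).length) (v : Fin N) :
    (toAlgorithm M p).action S t v = (M N).acts (p N)[t] (config S M p t) v := by
  unfold Algorithm.action
  rw [act_eq M p ht (length_history S _ t v), state_history S M p ht.le]
  rfl

theorem finalRole_eq (v : Fin N) :
    (toAlgorithm M p).finalRole S v =
      (M N).role v ((M N).run S (p N) (fun v => (M N).init v) v) := by
  change (M N).role v ((M N).state (p N) v ((toAlgorithm M p).history S (p N).length v)) = _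
  rw [state_history S M p le_rfl, config, List.take_length]

theorem energy_eq (v : Fin N) :
    (toAlgorithm M p).energy S v = (M N).spent S (p N) (fun v => (M N).init v) v := by
  have h : ∀ n ≤ (p N).length, ∑ t ∈ Finset.range n, ((toAlgorithm M p).action S t v).cost =
      (M N).spent S ((p N).take n) (fun v => (M N).init v) v := by
    intro n
    induction n with
    | zero => simp [spent]
    | succ n ih =>
      intro hn
      rw [sum_range_succ, ih (by omega), List.take_succ_eq_append_getElem hn, spent_append,
        action_eq S M p hn]
      rfl
  have := h _ le_rfl
  rwa [List.take_length] at this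

end Machine

/-! ### The algorithm -/

/-- The set of IDs of the devices in `S`. -/
def ids {N : ℕ} (S : Finset (Fin N)) : Finset ℕ :=
  S.map Fin.valEmbedding

theorem mem_ids {N : ℕ} {S : Finset (Fin N)} {x : ℕ} : x ∈ ids S ↔ ∃ v ∈ S, (v : ℕ) = x := by
  simp [ids]

theorem val_mem_ids {N : ℕ} {S : Finset (Fin N)} {v : Fin N} : (v : ℕ) ∈ ids S ↔ v ∈ S := by
  simp [ids, Fin.val_inj]

/-- A device stores the latest roster of its block that it knows (the empty set if the block has
been given up), and collects IDs that it hears of. -/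
structure Device where
  roster : Finset ℕ
  acc : Finset ℕ

/-- The kinds of slots: block `u` of level `l` reports its roster; the devices draw conclusions
from the reports of level `l`; device `x` reports its own ID; the device of rank `r` forwards what
it has collected to the next one; the announcement. -/
inductive Slot where
  | report (l u : ℕ)
  | commit (l : ℕ)
  | call (x : ℕ)
  | pass (r : ℕ)
  | announce

/-- The parameters of the algorithm: which teams are awake at which level, how many devices a block
must contain in order to survive, the number of levels, and the number of calls that a device
receives at the end. -/
structure Plan where
  path : ℕ → List Split
  thr : ℕ → ℕ
  top : ℕ
  load : ℕ

/-- The IDs contained in a perceived message. -/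
def heardIds : Perception → Finset ℕ
  | Perception.heard m => m.toFinset
  | _ => ∅

/-- `v` is the first element of `P` in its block of level `l`. -/
def IsFirst (l : ℕ) (P : Finset ℕ) (v : ℕ) : Prop :=
  v ∈ P ∧ ∀ w ∈ P, w / 2 ^ l = v / 2 ^ l → v ≤ w

theorem exists_isFirst {l v : ℕ} {P : Finset ℕ} (hv : v ∈ P) :
    ∃ w, IsFirst l P w ∧ w / 2 ^ l = v / 2 ^ l := by
  have hne : (cell l v P).Nonempty := ⟨v, mem_cell_self.2 hv⟩
  have h := mem_cell.1 (min'_mem _ hne)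
  exact ⟨(cell l v P).min' hne, ⟨h.1, fun w hw hwv => min'_le _ _ (mem_cell.2 ⟨hw, hwv.trans h.2⟩)⟩,
    h.2⟩

theorem IsFirst.eq {l v w : ℕ} {P : Finset ℕ} (hv : IsFirst l P v) (hw : IsFirst l P w)
    (h : w / 2 ^ l = v / 2 ^ l) : w = v :=
  le_antisymm (hw.2 v hv.1 h.symm) (hv.2 w hw.1 h)

theorem isFirst_cell {l v : ℕ} {P : Finset ℕ} : IsFirst l (cell l v P) v ↔ IsFirst l P v := by
  simp only [IsFirst, mem_cell, and_true]
  exact and_congr_right fun _ => forall_congr' fun w => by tauto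

namespace Plan

variable (pl : Plan)

/-- The members of `R` that are awake at level `l`. -/
def awake (l : ℕ) (R : Finset ℕ) : Finset ℕ :=
  team (pl.path l) R

open Classical in
/-- What a device knows about its block of level `l + 1` after the reports of level `l`. -/
noncomputable def known (l v : ℕ) (s : Device) : Finset ℕ :=
  -- A reporter hears nothing in its own slot, so its own roster has to be added by hand.
  s.acc ∪ if v ∈ pl.awake l s.roster then s.roster else ∅

open Classical in
/-- The actions of a device. -/
noncomputable def act : Slot → ℕ → Device → SlotAction
  | Slot.report l u, v, s =>
    if v / 2 ^ l = u ∧ IsFirst l (pl.awake l s.roster) v then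
      SlotAction.transmit (s.roster.sort (· ≤ ·))
    else if v / 2 ^ (l + 1) = u / 2 ∧ v ∈ pl.awake (l + 1) s.roster then SlotAction.listen
    else SlotAction.idle
  | Slot.commit _, _, _ => SlotAction.idle
  | Slot.call x, v, s =>
    if v = x then SlotAction.transmit [x]
    else if v ∈ s.roster ∧ rank s.roster v = x / pl.load then SlotAction.listen
    else SlotAction.idle
  | Slot.pass r, v, s =>
    if v ∈ s.roster ∧ rank s.roster v = r then
      SlotAction.transmit ((s.acc ∪ s.roster).sort (· ≤ ·))
    else if v ∈ s.roster ∧ rank s.roster v = r + 1 then SlotAction.listen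
    else SlotAction.idle
  | Slot.announce, v, s =>
    if v ∈ s.roster ∧ rank s.roster v + 1 = s.roster.card then
      SlotAction.transmit ((s.acc ∪ s.roster).sort (· ≤ ·))
    else SlotAction.listen

open Classical in
/-- The state changes of a device. -/
noncomputable def upd : Slot → ℕ → Device → Perception → Device
  | Slot.commit l, v, s, _ =>
    if v ∈ pl.awake (l + 1) s.roster then
      -- The block of `v` may have been given up while `v` slept; `v` discovers this by being absent
      -- from the reports.
      if v ∈ pl.known l v s ∧ pl.thr (l + 1) ≤ (pl.known l v s).card then ⟨pl.known l v s, ∅⟩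
      else ⟨∅, ∅⟩
    else ⟨s.roster, ∅⟩
  | _, _, s, x => ⟨s.roster, s.acc ∪ heardIds x⟩

open Classical in
/-- The behaviour of the devices. -/
noncomputable def machine : Machine Device Slot where
  init v := ⟨{v}, ∅⟩
  act := pl.act
  upd := pl.upd
  role v s := if v ∈ s.roster ∧ rank s.roster v + 1 = s.roster.card then Role.leader
    else Role.follower

/-- The slots in which the blocks of level `l` report. -/
def reports (l : ℕ) (U : List ℕ) : List Slot :=
  U.map (Slot.report l)

/-- The slots of level `l`. -/
def levelSlots (l : ℕ) : List Slot :=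
  reports l (List.range (2 ^ (pl.top - l))) ++ [Slot.commit l]

/-- The slots of the first `l` levels. -/
def slotsBelow : ℕ → List Slot
  | 0 => []
  | l + 1 => slotsBelow l ++ pl.levelSlots l

/-- The devices that take part at level `l`, if `X` is the set of all devices. -/
def alive (X : Finset ℕ) : ℕ → Finset ℕ
  | 0 => X
  | l + 1 => (alive X l).filter fun v => pl.thr (l + 1) ≤ (cell (l + 1) v (alive X l)).card

variable {pl} {X : Finset ℕ}

theorem alive_succ_subset (l : ℕ) : pl.alive X (l + 1) ⊆ pl.alive X l :=
  filter_subset _ _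

theorem alive_subset (l : ℕ) : pl.alive X l ⊆ X := by
  induction l with
  | zero => exact subset_rfl
  | succ l ih => exact (alive_succ_subset l).trans ih

theorem mem_alive_succ {l v : ℕ} : v ∈ pl.alive X (l + 1) ↔
    v ∈ pl.alive X l ∧ pl.thr (l + 1) ≤ (cell (l + 1) v (pl.alive X l)).card := by
  simp [alive]

/-- The survival test depends only on the block, so a block survives or is given up as a whole. -/
theorem cell_alive_succ {l v : ℕ} (h : v ∈ pl.alive X (l + 1)) :
    cell (l + 1) v (pl.alive X (l + 1)) = cell (l + 1) v (pl.alive X l) := by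
  ext w
  rw [mem_cell, mem_cell, mem_alive_succ]
  refine ⟨fun hw => ⟨hw.1.1, hw.2⟩, fun hw => ⟨⟨hw.1, ?_⟩, hw.2⟩⟩
  rw [cell_congr hw.2]
  exact (mem_alive_succ.1 h).2

/-- Surviving blocks are large. -/
theorem thr_le_card_cell {l : ℕ} : ∀ {k v : ℕ}, 0 < k → k ≤ l → v ∈ pl.alive X l →
    pl.thr k ≤ (cell k v (pl.alive X l)).card := by
  induction l with
  | zero => intro k v hk hkl; omega
  | succ l ih =>
    intro k v hk hkl hv
    rw [cell_eq_of_le hkl (cell_alive_succ hv)]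
    rcases hkl.lt_or_eq with h | rfl
    · exact ih hk (by omega) (mem_alive_succ.1 hv).1
    · exact (mem_alive_succ.1 hv).2

variable (pl X) in
/-- What is required of a plan if `X` is the set of devices: `E` bounds the number of levels at
which a device is awake. -/
structure Sound (E : ℕ) : Prop where
  consistent : ∀ l ≤ pl.top, ∀ p p' s, pl.path l = p ++ s :: p' → s.1 < l ∧ pl.path s.1 = p
  path_zero : pl.path 0 = []
  path_top : pl.path pl.top = []
  exists_awake : ∀ l ≤ pl.top, ∀ v ∈ pl.alive X l,
    ∃ w ∈ pl.awake l (pl.alive X l), w / 2 ^ l = v / 2 ^ l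
  card_awake : ∀ P v, ((range (pl.top + 1)).filter fun l => v ∈ pl.awake l P).card ≤ E

/-! ### Deciding from an old roster who is awake -/

theorem awake_subset (l : ℕ) (P : Finset ℕ) : pl.awake l P ⊆ P :=
  team_subset _ _

theorem forall_or_exists_first {α : Type*} (Q : α → Prop) (l : List α) :
    (∀ s ∈ l, Q s) ∨ ∃ p s p', l = p ++ s :: p' ∧ (∀ s' ∈ p, Q s') ∧ ¬ Q s := by
  induction l with
  | nil => simp
  | cons a l ih =>
    by_cases ha : Q a
    · rcases ih with h | ⟨p, s, p', rfl, h, hs⟩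
      · exact Or.inl (by simpa [ha] using h)
      · exact Or.inr ⟨a :: p, s, p', rfl, by simpa [ha] using h, hs⟩
    · exact Or.inr ⟨[], a, l, rfl, by simp, ha⟩

variable {E : ℕ}

theorem Sound.level_lt (h : pl.Sound X E) {l : ℕ} (hl : l ≤ pl.top) {s : Split}
    (hs : s ∈ pl.path l) : s.1 < l := by
  obtain ⟨p, p', hp⟩ := List.append_of_mem hs
  exact (h.consistent l hl p p' s hp).1

theorem Sound.cell_awake (h : pl.Sound X E) {l : ℕ} (hl : l ≤ pl.top) (v : ℕ) (P : Finset ℕ) :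
    cell l v (pl.awake l P) = pl.awake l (cell l v P) :=
  cell_team (fun _ hs => (h.level_lt hl hs).le) _ _

/-- A roster of level `k` of a device that has been asleep since tells whether it is awake. -/
theorem Sound.mem_awake_iff (h : pl.Sound X E) {k l j v : ℕ} {P R : Finset ℕ}
    (hR : cell k v R = cell k v P) (hsleep : ∀ i, k < i → i ≤ l → v ∉ pl.awake i R)
    (hj : j ≤ l + 1) (hjt : j ≤ pl.top) : v ∈ pl.awake j R ↔ v ∈ pl.awake j P := by
  -- The path is cut at its first split `s` above level `k`. The prefix is the path of level `s.1`,
  -- and `k < s.1 ≤ l`, so `v` slept there and is in no team derived from it; up to the cut, `R` and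
  -- `P` agree.
  rcases forall_or_exists_first (fun s : Split => s.1 ≤ k) (pl.path j) with
    h1 | ⟨p, s, p', h1, h2, h3⟩
  · exact mem_team_congr h1 hR
  · obtain ⟨h4, h5⟩ := h.consistent j hjt p p' s h1
    have h6 : v ∉ team p R := by
      rw [← h5]
      exact hsleep s.1 (by omega) (by omega)
    have h7 : v ∉ team p P := fun hv => h6 ((mem_team_congr h2 hR).2 hv)
    rw [awake, awake, h1, team_append, team_append]
    exact iff_of_false (fun hv => h6 (team_subset _ _ hv)) (fun hv => h7 (team_subset _ _ hv))

/-! ### Correctness of the merging of blocks -/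

variable {N : ℕ} {S : Finset (Fin N)}

variable (pl S) in
/-- What the active devices know at the beginning of level `l`. -/
def Informed (l : ℕ) (R : Fin N → Finset ℕ) : Prop :=
  ∀ v ∈ S, ((v : ℕ) ∈ pl.alive (ids S) l → ∃ k ≤ l,
    R v = cell k v (pl.alive (ids S) l) ∧ ∀ j, k < j → j ≤ l → (v : ℕ) ∉ pl.awake j (R v)) ∧
    ((v : ℕ) ∉ pl.alive (ids S) l → (v : ℕ) ∉ pl.awake l (R v))

/-- A roster of level `k` comes with sleep at all levels in `(k, l]`, so being awake at `l` forces
`k = l`. -/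
theorem Informed.roster_eq {l : ℕ} {R : Fin N → Finset ℕ} (h : pl.Informed S l R)
    {v : Fin N} (hv : v ∈ S) (hva : (v : ℕ) ∈ pl.awake l (R v)) :
    (v : ℕ) ∈ pl.alive (ids S) l ∧ R v = cell l v (pl.alive (ids S) l) := by
  have hal : (v : ℕ) ∈ pl.alive (ids S) l := by
    by_contra hcon
    exact (h v hv).2 hcon hva
  obtain ⟨k, hk, hR, hsleep⟩ := (h v hv).1 hal
  rcases hk.lt_or_eq with hk | rfl
  · exact absurd hva (hsleep l hk le_rfl)
  · exact ⟨hal, hR⟩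

theorem Informed.mem_awake_iff (hpl : pl.Sound (ids S) E) {l : ℕ} {R : Fin N → Finset ℕ}
    (h : pl.Informed S l R) {v : Fin N} (hv : v ∈ S) (hal : (v : ℕ) ∈ pl.alive (ids S) l) {j : ℕ}
    (hj : j ≤ l + 1) (hjt : j ≤ pl.top) :
    (v : ℕ) ∈ pl.awake j (R v) ↔ (v : ℕ) ∈ pl.awake j (pl.alive (ids S) l) := by
  obtain ⟨k, hk, hR, hsleep⟩ := (h v hv).1 hal
  refine hpl.mem_awake_iff (k := k) ?_ hsleep hj hjt
  rw [hR, cell_cell le_rfl]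

/-- An awake device holds the roster of its whole block, so its local test for being the reporter is
the global one. Thus no two devices of a block transmit together. -/
theorem Informed.isFirst_iff (hpl : pl.Sound (ids S) E) {l : ℕ} (hl : l ≤ pl.top)
    {R : Fin N → Finset ℕ} (h : pl.Informed S l R) {v : Fin N} (hv : v ∈ S) :
    IsFirst l (pl.awake l (R v)) v ↔ IsFirst l (pl.awake l (pl.alive (ids S) l)) v := by
  by_cases hva : (v : ℕ) ∈ pl.awake l (R v)
  · rw [(h.roster_eq hv hva).2, ← hpl.cell_awake hl, isFirst_cell]
  · refine iff_of_false (fun hc => hva hc.1) fun hc => hva ?_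
    exact (h.mem_awake_iff hpl hv (awake_subset _ _ hc.1) (Nat.le_succ l) hl).2 hc.1

/-- The channel in a slot in which block `u` reports. -/
theorem channel_report (hpl : pl.Sound (ids S) E) {l : ℕ} (hl : l ≤ pl.top) {c : Fin N → Device}
    (h : pl.Informed S l fun v => (c v).roster) (u : ℕ) :
    (channel S (pl.machine.acts (Slot.report l u) c)).elim ∅ List.toFinset =
      (pl.alive (ids S) l).filter fun w => w / 2 ^ l = u := by
  have hsent : ∀ v ∈ S, ¬ ((v : ℕ) / 2 ^ l = u ∧ IsFirst l (pl.awake l (c v).roster) v) →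
      (pl.machine.acts (Slot.report l u) c v).sent = none := by
    intro v _ hn
    simp only [Machine.acts, machine, act, if_neg hn]
    split_ifs <;> rfl
  by_cases hu : ∃ v ∈ pl.alive (ids S) l, v / 2 ^ l = u
  · obtain ⟨v, hv, rfl⟩ := hu
    obtain ⟨w, hw, hwv⟩ := hpl.exists_awake l hl v hv
    obtain ⟨x, hx, hxw⟩ := exists_isFirst (l := l) hw
    obtain ⟨y, hy, rfl⟩ := mem_ids.1 (alive_subset _ (awake_subset _ _ hx.1))
    have hyf : IsFirst l (pl.awake l (c y).roster) y := (h.isFirst_iff hpl hl hy).2 hx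
    have hyv : (y : ℕ) / 2 ^ l = v / 2 ^ l := hxw.trans hwv
    have hR := (h.roster_eq hy hyf.1).2
    rw [channel_eq_some (m := (c y).roster.sort (· ≤ ·)) hy]
    · simp only [Option.elim_some, sort_toFinset]
      rw [hR, cell, hyv]
    · simp only [Machine.acts, machine, act, if_pos (And.intro hyv hyf)]
      rfl
    · intro z hz hzy
      refine hsent z hz fun hcon => hzy (Fin.ext ?_)
      exact hx.eq ((h.isFirst_iff hpl hl hz).1 hcon.2) (hcon.1.trans hyv.symm)
  · rw [channel_eq_none]
    · rw [filter_false_of_mem fun w hw hwu => hu ⟨w, hw, hwu⟩]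
      rfl
    · intro v hv
      refine hsent v hv fun hcon => hu ⟨v, ?_, hcon.1⟩
      exact (h.roster_eq hv hcon.2.1).1

theorem heardIds_listen (o : Option Message) :
    heardIds (perceive SlotAction.listen o) = o.elim ∅ List.toFinset := by
  cases o <;> rfl

/-- The effect of a report. -/
theorem step_report (hpl : pl.Sound (ids S) E) {l : ℕ} (hl : l ≤ pl.top) {c : Fin N → Device}
    (h : pl.Informed S l fun v => (c v).roster) (u : ℕ) {v : Fin N} (hv : v ∈ S)
    (hva : (v : ℕ) ∈ pl.awake (l + 1) (c v).roster) (x : ℕ) :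
    x ∈ pl.known l v (pl.machine.step S (Slot.report l u) c v) ↔
      x ∈ pl.known l v (c v) ∨
        x ∈ pl.alive (ids S) l ∧ x / 2 ^ l = u ∧ u / 2 = (v : ℕ) / 2 ^ (l + 1) := by
  have hch := channel_report hpl hl h u
  have hown : (v : ℕ) ∈ pl.awake l (c v).roster →
      (c v).roster = cell l v (pl.alive (ids S) l) := fun hx => (h.roster_eq hv hx).2
  have hdiv : ∀ y : ℕ, y / 2 ^ (l + 1) = y / 2 ^ l / 2 := fun y => by
    rw [pow_succ, Nat.div_div_eq_div_mul]
  have hstep : (pl.machine.step S (Slot.report l u) c v) = ⟨(c v).roster, (c v).acc ∪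
      heardIds (perceive (pl.machine.acts (Slot.report l u) c v)
        (channel S (pl.machine.acts (Slot.report l u) c)))⟩ := rfl
  have hact : pl.machine.acts (Slot.report l u) c v = pl.act (Slot.report l u) v (c v) := rfl
  rw [hstep, hact]
  simp only [known, mem_union]
  -- The reporter learns nothing, but block `u` is its own roster, already counted in `known`.
  by_cases h1 : (v : ℕ) / 2 ^ l = u ∧ IsFirst l (pl.awake l (c v).roster) v
  · simp only [act, if_pos h1, perceive, heardIds, notMem_empty, or_false]
    rw [if_pos h1.2.1, hown h1.2.1, mem_cell, h1.1]
    have := hdiv v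
    rw [h1.1] at this
    tauto
  · by_cases h2 : (v : ℕ) / 2 ^ (l + 1) = u / 2
    · have h3 : pl.act (Slot.report l u) v (c v) = SlotAction.listen := by
        simp only [act, if_neg h1]
        rw [if_pos ⟨h2, hva⟩]
      rw [h3, heardIds_listen, hch, mem_filter]
      have h4 := h2.symm
      tauto
    · have h3 : ¬ ((v : ℕ) / 2 ^ (l + 1) = u / 2 ∧ (v : ℕ) ∈ pl.awake (l + 1) (c v).roster) :=
        fun hc => h2 hc.1
      simp only [act, if_neg h1, if_neg h3, perceive, heardIds, notMem_empty, or_false]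
      tauto

theorem run_reports_roster (l : ℕ) (U : List ℕ) : ∀ (c : Fin N → Device) (v : Fin N),
    (pl.machine.run S (reports l U) c v).roster = (c v).roster := by
  induction U with
  | nil => exact fun c v => rfl
  | cons u U ih => exact fun c v => ih _ v

/-- The effect of several reports. -/
theorem run_reports (hpl : pl.Sound (ids S) E) {l : ℕ} (hl : l ≤ pl.top) (U : List ℕ) :
    ∀ c : Fin N → Device, pl.Informed S l (fun v => (c v).roster) → ∀ v ∈ S,
      (v : ℕ) ∈ pl.awake (l + 1) (c v).roster → ∀ x,
        (x ∈ pl.known l v (pl.machine.run S (reports l U) c v) ↔ x ∈ pl.known l v (c v) ∨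
          x ∈ pl.alive (ids S) l ∧ x / 2 ^ l ∈ U ∧ x / 2 ^ (l + 1) = (v : ℕ) / 2 ^ (l + 1)) := by
  induction U with
  | nil => intro c _ v _ _ x; simp [reports]
  | cons u U ih =>
    intro c h v hv hva x
    have h1 := ih (pl.machine.step S (Slot.report l u) c) h v hv hva x
    rw [step_report hpl hl h u hv hva x] at h1
    have hdiv : x / 2 ^ (l + 1) = x / 2 ^ l / 2 := by
      rw [pow_succ, Nat.div_div_eq_div_mul]
    have h2 : x / 2 ^ l = u ∧ u / 2 = (v : ℕ) / 2 ^ (l + 1) ↔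
        x / 2 ^ l = u ∧ x / 2 ^ (l + 1) = (v : ℕ) / 2 ^ (l + 1) := by
      refine and_congr_right fun hxu => ?_
      rw [hdiv, hxu]
    rw [h2] at h1
    simp only [reports, List.map_cons, Machine.run_cons, List.mem_cons] at h1 ⊢
    rw [h1]
    tauto

/-- After the reports of a level, the devices that are woken know their block of the next level. -/
theorem known_eq (hpl : pl.Sound (ids S) E) {l : ℕ} (hl : l < pl.top) (hN : N ≤ 2 ^ pl.top)
    {c : Fin N → Device} (h : pl.Informed S l fun v => (c v).roster) (hacc : ∀ v ∈ S, (c v).acc = ∅)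
    {v : Fin N} (hv : v ∈ S) (hva : (v : ℕ) ∈ pl.awake (l + 1) (c v).roster) :
    pl.known l v (pl.machine.run S (reports l (List.range (2 ^ (pl.top - l)))) c v) =
      cell (l + 1) v (pl.alive (ids S) l) := by
  ext x
  rw [run_reports hpl hl.le _ c h v hv hva x, mem_cell]
  have h1 : x ∈ pl.known l v (c v) → x ∈ pl.alive (ids S) l ∧
      x / 2 ^ (l + 1) = (v : ℕ) / 2 ^ (l + 1) := by
    simp only [known, hacc v hv, empty_union]
    split_ifs with h2
    · intro hx
      rw [(h.roster_eq hv h2).2, mem_cell] at hx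
      exact ⟨hx.1, block_eq_of_le (Nat.le_succ l) hx.2⟩
    · simp
  -- All IDs lie below `2 ^ top`, so every nonempty block has its slot.
  have h2 : x ∈ pl.alive (ids S) l → x / 2 ^ l ∈ List.range (2 ^ (pl.top - l)) := by
    intro hx
    obtain ⟨y, _, rfl⟩ := mem_ids.1 (alive_subset _ hx)
    rw [List.mem_range]
    refine Nat.div_lt_of_lt_mul ?_
    rw [← pow_add, Nat.add_sub_cancel' hl.le]
    exact y.2.trans_le hN
  tauto

theorem informed_zero :
    pl.Informed S 0 fun v => (pl.machine.init v).roster := by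
  intro v hv
  refine ⟨fun _ => ⟨0, le_rfl, ?_, fun j h1 h2 => by omega⟩, fun hn => ?_⟩
  · ext x
    simp only [machine, mem_singleton, mem_cell, pow_zero, Nat.div_one]
    refine ⟨fun h => ⟨?_, h⟩, fun h => h.2⟩
    rw [h]
    exact val_mem_ids.2 hv
  · exact absurd (val_mem_ids.2 hv) hn

/-- The roster of a device after level `l`. -/
theorem roster_run_level (hpl : pl.Sound (ids S) E) {l : ℕ} (hl : l < pl.top)
    (hN : N ≤ 2 ^ pl.top) {c : Fin N → Device} (h : pl.Informed S l fun v => (c v).roster)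
    (hacc : ∀ v ∈ S, (c v).acc = ∅) {v : Fin N} (hv : v ∈ S) :
    pl.machine.run S (pl.levelSlots l) c v = ⟨(open Classical in
      if (v : ℕ) ∈ pl.awake (l + 1) (c v).roster then
        if (v : ℕ) ∈ pl.alive (ids S) (l + 1) then cell (l + 1) v (pl.alive (ids S) (l + 1)) else ∅
      else (c v).roster), ∅⟩ := by
  have hrun : pl.machine.run S (pl.levelSlots l) c v = pl.upd (Slot.commit l) v
      (pl.machine.run S (reports l (List.range (2 ^ (pl.top - l)))) c v) Perception.nothing := by
    rw [levelSlots, Machine.run_append]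
    rfl
  rw [hrun]
  simp only [upd, run_reports_roster]
  by_cases hva : (v : ℕ) ∈ pl.awake (l + 1) (c v).roster
  · rw [if_pos hva, if_pos hva, known_eq hpl hl hN h hacc hv hva]
    by_cases hal : (v : ℕ) ∈ pl.alive (ids S) (l + 1)
    · have h2 := mem_alive_succ.1 hal
      rw [if_pos hal, if_pos ⟨mem_cell_self.2 h2.1, h2.2⟩, cell_alive_succ hal]
    · rw [if_neg hal, if_neg fun hc => hal (mem_alive_succ.2 ⟨mem_cell_self.1 hc.1, hc.2⟩)]
  · rw [if_neg hva, if_neg hva]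

theorem informed_succ (hpl : pl.Sound (ids S) E) {l : ℕ} (hl : l < pl.top)
    (hN : N ≤ 2 ^ pl.top) {c : Fin N → Device} (h : pl.Informed S l fun v => (c v).roster)
    (hacc : ∀ v ∈ S, (c v).acc = ∅) :
    pl.Informed S (l + 1) fun v => (pl.machine.run S (pl.levelSlots l) c v).roster := by
  intro v hv
  simp only [roster_run_level hpl hl hN h hacc hv]
  by_cases hva : (v : ℕ) ∈ pl.awake (l + 1) (c v).roster
  · by_cases hal : (v : ℕ) ∈ pl.alive (ids S) (l + 1)
    · simp only [if_pos hva, if_pos hal]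
      exact ⟨fun _ => ⟨l + 1, le_rfl, rfl, fun j h1 h2 => by omega⟩, fun hn => absurd hal hn⟩
    · simp only [if_pos hva, if_neg hal]
      exact ⟨fun hc => absurd hc hal, fun _ hc => by simpa using awake_subset _ _ hc⟩
  · simp only [if_neg hva]
    refine ⟨fun hal => ?_, fun _ => hva⟩
    obtain ⟨k, hk, hR, hsleep⟩ := (h v hv).1 (alive_succ_subset l hal)
    refine ⟨k, by omega, ?_, fun j h1 h2 => ?_⟩
    -- A device that is not woken keeps its old roster, which stays correct since a surviving block
    -- loses nobody.
    · exact hR.trans (cell_eq_of_le (by omega) (cell_alive_succ hal)).symm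
    · rcases h2.lt_or_eq with h3 | rfl
      · exact hsleep j h1 (by omega)
      · exact hva

/-! ### Energy of the merging of blocks -/

theorem sum_map_range (f : ℕ → ℕ) (n : ℕ) : ((List.range n).map f).sum = ∑ u ∈ range n, f u := by
  induction n with
  | zero => rfl
  | succ n ih => rw [List.range_succ, List.map_append, List.sum_append, ih, sum_range_succ]; simp

open Classical in
-- At most one transmission for the device's own block, and listening to the two children of its
-- parent block.
theorem spent_level (l : ℕ) (c : Fin N → Device) (v : Fin N) :
    pl.machine.spent S (pl.levelSlots l) c v ≤
      (if (v : ℕ) ∈ pl.awake l (c v).roster then 1 else 0) +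
        2 * (if (v : ℕ) ∈ pl.awake (l + 1) (c v).roster then 1 else 0) := by
  set R := (c v).roster with hR
  set n := 2 ^ (pl.top - l)
  have h1 : pl.machine.spent S (pl.levelSlots l) c v =
      pl.machine.spent S (reports l (List.range n)) c v := by
    rw [levelSlots, Machine.spent_append]
    rfl
  set f : ℕ → ℕ := fun u => (if u = (v : ℕ) / 2 ^ l then
    (if (v : ℕ) ∈ pl.awake l R then 1 else 0) else 0) +
      if u ∈ Ico (2 * ((v : ℕ) / 2 ^ (l + 1))) (2 * ((v : ℕ) / 2 ^ (l + 1)) + 2) then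
        (if (v : ℕ) ∈ pl.awake (l + 1) R then 1 else 0) else 0 with hf
  have h2 := pl.machine.spent_le S (v := v) (fun s => s.roster = R)
    (fun d => match d with | Slot.report _ u => f u | _ => 0) (reports l (List.range n))
    (by
      intro d hd s x hs
      obtain ⟨u, _, rfl⟩ := List.mem_map.1 hd
      exact hs)
    (by
      intro d hd s hs
      obtain ⟨u, _, rfl⟩ := List.mem_map.1 hd
      simp only [machine, act, hs, hf, mem_Ico]
      split_ifs with h3 h4 h5 h6 h7 <;> simp only [SlotAction.cost] <;>
        first
        | omega
        | (exfalso; first | exact h5 h3.2.1 | omega | tauto))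
    c rfl
  rw [h1]
  refine h2.trans ?_
  have h3 : ((reports l (List.range n)).map
      fun d => match d with | Slot.report _ u => f u | _ => 0).sum = ∑ u ∈ range n, f u := by
    rw [← sum_map_range, reports, List.map_map]
    rfl
  rw [h3, hf, sum_add_distrib]
  refine Nat.add_le_add ?_ ?_
  · rw [sum_ite_eq' ]
    split_ifs <;> simp
  · rw [← sum_filter, sum_const, smul_eq_mul]
    refine Nat.mul_le_mul_right _ ?_
    refine (card_le_card (t := Ico (2 * ((v : ℕ) / 2 ^ (l + 1))) (2 * ((v : ℕ) / 2 ^ (l + 1)) + 2))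
      fun x hx => (mem_filter.1 hx).2).trans ?_
    simp

/-- The states at the beginning of level `l`. -/
noncomputable def configAt (pl : Plan) (S : Finset (Fin N)) (l : ℕ) : Fin N → Device :=
  pl.machine.run S (pl.slotsBelow l) fun v => pl.machine.init v

theorem configAt_succ (l : ℕ) :
    pl.configAt S (l + 1) = pl.machine.run S (pl.levelSlots l) (pl.configAt S l) := by
  rw [configAt, slotsBelow, Machine.run_append]
  rfl

theorem informed_configAt (hpl : pl.Sound (ids S) E) (hN : N ≤ 2 ^ pl.top) {l : ℕ}
    (hl : l ≤ pl.top) : pl.Informed S l (fun v => (pl.configAt S l v).roster) ∧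
      ∀ v ∈ S, (pl.configAt S l v).acc = ∅ := by
  induction l with
  | zero => exact ⟨informed_zero, fun v _ => rfl⟩
  | succ l ih =>
    obtain ⟨h1, h2⟩ := ih (by omega)
    rw [configAt_succ]
    exact ⟨informed_succ hpl hl hN h1 h2, fun v hv => by
      rw [roster_run_level hpl hl hN h1 h2 hv]⟩

/-- The levels below `l` at which a device with roster `R` is awake. -/
def awakeLevels (pl : Plan) (l : ℕ) (R : Finset ℕ) (v : ℕ) : Finset ℕ :=
  (range l).filter fun j => v ∈ pl.awake j R

theorem card_awakeLevels_succ (l : ℕ) (R : Finset ℕ) (v : ℕ) :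
    (pl.awakeLevels (l + 1) R v).card = (pl.awakeLevels l R v).card +
      (open Classical in if v ∈ pl.awake l R then 1 else 0) := by
  unfold awakeLevels
  rw [range_add_one, filter_insert]
  by_cases h : v ∈ pl.awake l R
  · rw [if_pos h, if_pos h, card_insert_of_notMem (by simp)]
  · rw [if_neg h, if_neg h, add_zero]

theorem Sound.card_awakeLevels_le (hpl : pl.Sound X E) {l : ℕ} (hl : l ≤ pl.top + 1)
    (R : Finset ℕ) (v : ℕ) : (pl.awakeLevels l R v).card ≤ E :=
  (card_le_card (filter_subset_filter _ (range_subset_range.2 hl))).trans (hpl.card_awake R v)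

/-- Energy is charged to waking levels computed from the current roster. Once a block is given up
the roster is empty and this count vanishes, hence the separate alternative; its extra 2 pays for
listening before the block is given up. -/
theorem spent_slotsBelow (hpl : pl.Sound (ids S) E) (hN : N ≤ 2 ^ pl.top) {v : Fin N}
    (hv : v ∈ S) {l : ℕ} (hl : l ≤ pl.top) :
    ((pl.configAt S l v).roster = ∅ ∧
      pl.machine.spent S (pl.slotsBelow l) (fun v => pl.machine.init v) v ≤ 3 * E + 2) ∨
    pl.machine.spent S (pl.slotsBelow l) (fun v => pl.machine.init v) v ≤
      2 * (pl.awakeLevels (l + 1) (pl.configAt S l v).roster v).card +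
        (pl.awakeLevels l (pl.configAt S l v).roster v).card := by
  classical
  induction l with
  | zero => exact Or.inr (Nat.zero_le _)
  | succ l ih =>
    obtain ⟨hinf, hacc⟩ := informed_configAt hpl hN (l := l) (by omega)
    have hlev := spent_level (pl := pl) (S := S) l (pl.configAt S l) v
    have hsp : pl.machine.spent S (pl.slotsBelow (l + 1)) (fun v => pl.machine.init v) v =
        pl.machine.spent S (pl.slotsBelow l) (fun v => pl.machine.init v) v +
          pl.machine.spent S (pl.levelSlots l) (pl.configAt S l) v := by
      rw [slotsBelow, Machine.spent_append]
      rfl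
    rw [hsp, configAt_succ, roster_run_level hpl hl hN hinf hacc hv]
    set R := (pl.configAt S l v).roster with hR
    have hc1 := card_awakeLevels_succ (pl := pl) l R v
    have hc2 := card_awakeLevels_succ (pl := pl) (l + 1) R v
    have hE := hpl.card_awakeLevels_le (l := l + 1) (by omega) R v
    have hE2 := hpl.card_awakeLevels_le (l := l + 1 + 1) (by omega) R v
    rcases ih (by omega) with ⟨h0, h1⟩ | h1
    · have hn : ∀ j, (v : ℕ) ∉ pl.awake j R := fun j hj => by
        have := awake_subset _ _ hj
        rw [h0] at this
        simp at this
      rw [if_neg (hn _), if_neg (hn _)] at hlev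
      simp only [if_neg (hn _)]
      exact Or.inl ⟨h0, by omega⟩
    · by_cases hva : (v : ℕ) ∈ pl.awake (l + 1) R
      · by_cases hal : (v : ℕ) ∈ pl.alive (ids S) (l + 1)
        · right
          simp only [if_pos hva, if_pos hal]
          -- Replacing the roster does not rewrite the past: being awake at `j ≤ l + 1` depends only
          -- on splits at levels at most `l`, where the blocks are unchanged.
          have hsame : ∀ j ≤ l + 1, ((v : ℕ) ∈ pl.awake j (cell (l + 1) v (pl.alive (ids S) (l + 1)))
              ↔ (v : ℕ) ∈ pl.awake j R) := by
            intro j hj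
            rw [hinf.mem_awake_iff hpl hv (alive_succ_subset l hal) hj (by omega)]
            refine mem_team_congr (k := l) (fun s hs => ?_) ?_
            · have := hpl.level_lt (by omega) hs
              omega
            · rw [cell_cell (by omega), cell_eq_of_le (Nat.le_succ l) (cell_alive_succ hal)]
          have hset : ∀ n ≤ l + 2,
              pl.awakeLevels n (cell (l + 1) v (pl.alive (ids S) (l + 1))) v =
                pl.awakeLevels n R v := by
            intro n hn
            refine filter_congr fun j hj => hsame j ?_
            have := mem_range.1 hj
            omega
          rw [hset (l + 1 + 1) le_rfl, hset (l + 1) (by omega)]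
          rw [if_pos hva] at hlev hc2
          omega
        · left
          simp only [if_pos hva, if_neg hal, true_and]
          rw [if_pos hva] at hlev
          omega
      · right
        simp only [if_neg hva]
        rw [if_neg hva] at hlev hc2
        omega

theorem spent_slotsBelow_top (hpl : pl.Sound (ids S) E) (hN : N ≤ 2 ^ pl.top) {v : Fin N}
    (hv : v ∈ S) :
    pl.machine.spent S (pl.slotsBelow pl.top) (fun v => pl.machine.init v) v ≤ 3 * E + 2 := by
  have h1 := hpl.card_awakeLevels_le (l := pl.top + 1) le_rfl (pl.configAt S pl.top v).roster v
  have h2 := hpl.card_awakeLevels_le (l := pl.top) (Nat.le_succ _)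
    (pl.configAt S pl.top v).roster v
  rcases spent_slotsBelow hpl hN hv le_rfl with h | h
  · exact h.2
  · omega

/-- In the end the surviving devices know each other, and the others know that they do not
survive. -/
theorem roster_configAt_top (hpl : pl.Sound (ids S) E) (hN : N ≤ 2 ^ pl.top) {v : Fin N}
    (hv : v ∈ S) :
    ((v : ℕ) ∈ pl.alive (ids S) pl.top →
      (pl.configAt S pl.top v).roster = pl.alive (ids S) pl.top) ∧
    ((v : ℕ) ∉ pl.alive (ids S) pl.top → (v : ℕ) ∉ (pl.configAt S pl.top v).roster) := by
  obtain ⟨h, _⟩ := informed_configAt hpl hN (l := pl.top) le_rfl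
  have haw : ∀ P, pl.awake pl.top P = P := fun P => by rw [awake, hpl.path_top, team_nil]
  refine ⟨fun hal => ?_, fun hal => ?_⟩
  · have h1 := (h.mem_awake_iff hpl hv hal (Nat.le_succ _) le_rfl).2 (by rwa [haw])
    rw [(h.roster_eq hv h1).2]
    have hlt : ∀ u : Fin N, (u : ℕ) / 2 ^ pl.top = 0 := fun u =>
      Nat.div_eq_of_lt (u.2.trans_le hN)
    refine filter_true_of_mem fun w hw => ?_
    obtain ⟨y, _, rfl⟩ := mem_ids.1 (alive_subset _ hw)
    rw [hlt, hlt]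
  · have := (h v hv).2 hal
    rwa [haw] at this

end Plan

namespace Plan

/-! ### The final phase -/

variable (pl : Plan)

/-- The slots in which all devices report their own IDs. -/
def callSlots (U : List ℕ) : List Slot :=
  U.map Slot.call

/-- The slots in which the first `n` devices of the final roster forward their knowledge. -/
def passSlots (n : ℕ) : List Slot :=
  (List.range n).map Slot.pass

/-- All slots but the last one. -/
def mainSlots : List Slot :=
  pl.slotsBelow pl.top ++ (callSlots (List.range (2 ^ pl.top)) ++ passSlots (2 ^ pl.top))

/-- All slots. -/
def slots : List Slot :=
  pl.mainSlots ++ [Slot.announce]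

variable {pl} {N : ℕ} {S : Finset (Fin N)} {Q : Finset ℕ}

/-- The members of `Q` know `Q`, and the other devices know that they do not belong to `Q`. -/
def Ready (S : Finset (Fin N)) (Q : Finset ℕ) (R : Fin N → Finset ℕ) : Prop :=
  ∀ v ∈ S, ((v : ℕ) ∈ Q → R v = Q) ∧ ((v : ℕ) ∉ Q → (v : ℕ) ∉ R v)

theorem Ready.mem_iff {R : Fin N → Finset ℕ} (h : Ready S Q R) {v : Fin N} (hv : v ∈ S) :
    (v : ℕ) ∈ R v ↔ (v : ℕ) ∈ Q := by
  by_cases hQ : (v : ℕ) ∈ Q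
  · rw [(h v hv).1 hQ]
  · exact iff_of_false ((h v hv).2 hQ) hQ

theorem Ready.mem_rank_iff {R : Fin N → Finset ℕ} (h : Ready S Q R) {v : Fin N} (hv : v ∈ S)
    (r : ℕ) : ((v : ℕ) ∈ R v ∧ rank (R v) v = r) ↔ ((v : ℕ) ∈ Q ∧ rank Q v = r) := by
  rw [h.mem_iff hv]
  exact and_congr_right fun hQ => by rw [(h v hv).1 hQ]

theorem heardIds_subset {a : Fin N → SlotAction} {X : Finset ℕ} (b : SlotAction)
    (h : ∀ v ∈ S, ∀ m, (a v).sent = some m → m.toFinset ⊆ X) :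
    heardIds (perceive b (channel S a)) ⊆ X := by
  cases hch : channel S a with
  | none => cases b <;> exact empty_subset _
  | some m =>
    obtain ⟨v, hv, hm⟩ := exists_of_channel hch
    cases b
    · exact empty_subset _
    · exact h v hv m hm
    · exact empty_subset _

theorem step_call_acc (x : ℕ) (c : Fin N → Device) (v : Fin N) :
    pl.machine.step S (Slot.call x) c v = ⟨(c v).roster, (c v).acc ∪
      heardIds (perceive (pl.machine.acts (Slot.call x) c v)
        (channel S (pl.machine.acts (Slot.call x) c)))⟩ := rfl

theorem step_pass_acc (r : ℕ) (c : Fin N → Device) (v : Fin N) :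
    pl.machine.step S (Slot.pass r) c v = ⟨(c v).roster, (c v).acc ∪
      heardIds (perceive (pl.machine.acts (Slot.pass r) c v)
        (channel S (pl.machine.acts (Slot.pass r) c)))⟩ := rfl

theorem step_call_subset (x : ℕ) {c : Fin N → Device} {v : Fin N} (h : (c v).acc ⊆ ids S) :
    (pl.machine.step S (Slot.call x) c v).acc ⊆ ids S := by
  rw [step_call_acc]
  refine union_subset h (heardIds_subset _ fun w hw m hm => ?_)
  simp only [Machine.acts, machine, act] at hm
  split_ifs at hm with h1 h2
  · simp only [SlotAction.sent, Option.some.injEq] at hm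
    rw [← hm, ← h1]
    simpa using val_mem_ids.2 hw
  · simp [SlotAction.sent] at hm
  · simp [SlotAction.sent] at hm

theorem step_pass_subset (r : ℕ) {c : Fin N → Device} (hc : Ready S Q fun v => (c v).roster)
    (hQ : Q ⊆ ids S) (h : ∀ v ∈ S, (c v).acc ⊆ ids S) {v : Fin N} (hv : v ∈ S) :
    (pl.machine.step S (Slot.pass r) c v).acc ⊆ ids S := by
  rw [step_pass_acc]
  refine union_subset (h v hv) (heardIds_subset _ fun w hw m hm => ?_)
  simp only [Machine.acts, machine, act] at hm
  split_ifs at hm with h1 h2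
  · simp only [SlotAction.sent, Option.some.injEq] at hm
    rw [← hm, sort_toFinset]
    refine union_subset (h w hw) ?_
    have h3 : (c w).roster = Q := (hc w hw).1 ((hc.mem_iff hw).1 h1.1)
    rwa [h3]
  · simp [SlotAction.sent] at hm
  · simp [SlotAction.sent] at hm

theorem mem_step_call {x : ℕ} {c : Fin N → Device} (hc : Ready S Q fun v => (c v).roster)
    {v : Fin N} (hv : v ∈ S) (hvQ : (v : ℕ) ∈ Q) (hx : x ∈ ids S) (hr : rank Q v = x / pl.load) :
    x ∈ (pl.machine.step S (Slot.call x) c v).acc ∪ Q := by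
  -- The caller cannot listen to itself, but then `x` lies in `Q`; this is why knowledge is measured
  -- by `acc ∪ Q`.
  by_cases hvx : (v : ℕ) = x
  · exact mem_union_right _ (hvx ▸ hvQ)
  · obtain ⟨u, hu, rfl⟩ := mem_ids.1 hx
    have hch : channel S (pl.machine.acts (Slot.call u) c) = some [(u : ℕ)] := by
      refine channel_eq_some hu ?_ fun w _ hwu => ?_
      · simp [Machine.acts, machine, act, SlotAction.sent]
      · simp only [Machine.acts, machine, act, if_neg (fun h => hwu (Fin.ext h))]
        split_ifs <;> rfl
    have hact : pl.machine.acts (Slot.call u) c v = SlotAction.listen := by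
      simp only [Machine.acts, machine, act, if_neg hvx]
      rw [if_pos ((hc.mem_rank_iff hv _).2 ⟨hvQ, hr⟩)]
    rw [step_call_acc, hch, hact]
    simp [perceive, heardIds]

/-- The effect of the calls. -/
theorem run_calls (U : List ℕ) : ∀ c : Fin N → Device,
    (Ready S Q fun v => (c v).roster) → (∀ v ∈ S, (c v).acc ⊆ ids S) → ∀ v ∈ S,
      (pl.machine.run S (callSlots U) c v).roster = (c v).roster ∧
      (c v).acc ⊆ (pl.machine.run S (callSlots U) c v).acc ∧
      (pl.machine.run S (callSlots U) c v).acc ⊆ ids S ∧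
      ((v : ℕ) ∈ Q → ∀ x ∈ ids S, x ∈ U → x / pl.load = rank Q v →
        x ∈ (pl.machine.run S (callSlots U) c v).acc ∪ Q) := by
  induction U with
  | nil => exact fun c _ h v hv => ⟨rfl, subset_rfl, h v hv, fun _ x _ hx => by simp at hx⟩
  | cons y U ih =>
    intro c hc h v hv
    obtain ⟨h1, h2, h3, h4⟩ := ih (pl.machine.step S (Slot.call y) c) hc
      (fun w hw => step_call_subset y (h w hw)) v hv
    refine ⟨h1, ?_, h3, fun hvQ x hx hxU hr => ?_⟩
    · refine subset_trans ?_ h2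
      rw [step_call_acc]
      exact subset_union_left
    · rcases List.mem_cons.1 hxU with rfl | hxU
      · exact union_subset_union_left h2 (mem_step_call hc hv hvQ hx hr.symm)
      · exact h4 hvQ x hx hxU hr

theorem mem_step_pass {r : ℕ} {c : Fin N → Device} (hc : Ready S Q fun v => (c v).roster)
    (hQ : Q ⊆ ids S) {v : Fin N} (hv : v ∈ S) (hvQ : (v : ℕ) ∈ Q) (hr : rank Q v = r + 1) :
    ∃ u ∈ S, (u : ℕ) ∈ Q ∧ rank Q u = r ∧
      (c u).acc ⊆ (pl.machine.step S (Slot.pass r) c v).acc := by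
  have hlt : r < Q.card := by
    have := rank_lt_card hvQ
    omega
  obtain ⟨y, hy, hyr⟩ := exists_rank_eq hlt
  obtain ⟨u, hu, rfl⟩ := mem_ids.1 (hQ hy)
  refine ⟨u, hu, hy, hyr, ?_⟩
  have hch : channel S (pl.machine.acts (Slot.pass r) c) =
      some (((c u).acc ∪ (c u).roster).sort (· ≤ ·)) := by
    refine channel_eq_some hu ?_ fun w hw hwu => ?_
    · simp only [Machine.acts, machine, act]
      rw [if_pos ((hc.mem_rank_iff hu _).2 ⟨hy, hyr⟩)]
      rfl
    · simp only [Machine.acts, machine, act]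
      rw [if_neg fun h => ?_]
      · split_ifs <;> rfl
      · have h' := (hc.mem_rank_iff hw _).1 h
        exact hwu (Fin.ext (rank_injOn Q h'.1 hy (h'.2.trans hyr.symm)))
  have hact : pl.machine.acts (Slot.pass r) c v = SlotAction.listen := by
    simp only [Machine.acts, machine, act]
    rw [if_neg fun h => ?_, if_pos ((hc.mem_rank_iff hv _).2 ⟨hvQ, hr⟩)]
    have := ((hc.mem_rank_iff hv _).1 h).2
    omega
  rw [step_pass_acc, hch, hact]
  simp only [perceive, heardIds, sort_toFinset]
  exact subset_union_left.trans subset_union_right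

/-- The effect of the passes. -/
theorem run_passes (hQ : Q ⊆ ids S) {c : Fin N → Device} (hc : Ready S Q fun v => (c v).roster)
    (h : ∀ v ∈ S, (c v).acc ⊆ ids S)
    (hown : ∀ v ∈ S, (v : ℕ) ∈ Q → ∀ x ∈ ids S, x / pl.load = rank Q v → x ∈ (c v).acc ∪ Q)
    (n : ℕ) : ∀ v ∈ S,
      (pl.machine.run S (passSlots n) c v).roster = (c v).roster ∧
      (c v).acc ⊆ (pl.machine.run S (passSlots n) c v).acc ∧
      (pl.machine.run S (passSlots n) c v).acc ⊆ ids S ∧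
      ((v : ℕ) ∈ Q → rank Q v ≤ n → ∀ x ∈ ids S, x / pl.load ≤ rank Q v →
        x ∈ (pl.machine.run S (passSlots n) c v).acc ∪ Q) := by
  induction n with
  | zero =>
    exact fun v hv => ⟨rfl, subset_rfl, h v hv, fun hvQ hr x hx hxr =>
      hown v hv hvQ x hx (le_antisymm hxr (hr.trans (Nat.zero_le _)))⟩
  | succ n ih =>
    intro v hv
    have hrun : pl.machine.run S (passSlots (n + 1)) c =
        pl.machine.step S (Slot.pass n) (pl.machine.run S (passSlots n) c) := by
      rw [passSlots, List.range_succ, List.map_append, Machine.run_append]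
      rfl
    set c' := pl.machine.run S (passSlots n) c with hc'
    have hready : Ready S Q fun v => (c' v).roster := fun w hw => by
      simp only [(ih w hw).1]
      exact hc w hw
    rw [hrun]
    obtain ⟨h1, h2, h3, h4⟩ := ih v hv
    have hmono : (c' v).acc ⊆ (pl.machine.step S (Slot.pass n) c' v).acc := by
      rw [step_pass_acc]
      exact subset_union_left
    refine ⟨h1, h2.trans hmono, step_pass_subset n hready hQ (fun w hw => (ih w hw).2.2.1) hv,
      fun hvQ hr x hx hxr => ?_⟩
    by_cases hrn : rank Q v ≤ n
    · exact union_subset_union_left hmono (h4 hvQ hrn x hx hxr)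
    · by_cases hxe : x / pl.load = rank Q v
      · exact union_subset_union_left (h2.trans hmono) (hown v hv hvQ x hx hxe)
      -- Here `v` has rank `n + 1` and `x` belongs to an earlier rank, so `x` is received from the
      -- predecessor `u` of rank `n`.
      · obtain ⟨u, hu, huQ, hur, hsub⟩ := mem_step_pass (pl := pl) (r := n) hready hQ hv hvQ
          (by omega)
        exact union_subset_union_left hsub
          ((ih u hu).2.2.2 huQ hur.le x hx (by omega))

variable {E : ℕ}

/-- The states before the last slot. -/
theorem run_mainSlots (hpl : pl.Sound (ids S) E) (hN : N ≤ 2 ^ pl.top)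
    (hload : 2 ^ pl.top ≤ pl.load * (pl.alive (ids S) pl.top).card) :
    (Ready S (pl.alive (ids S) pl.top) fun v =>
      (pl.machine.run S pl.mainSlots (fun v => pl.machine.init v) v).roster) ∧
    ∀ v ∈ S, (v : ℕ) ∈ pl.alive (ids S) pl.top →
      rank (pl.alive (ids S) pl.top) v + 1 = (pl.alive (ids S) pl.top).card →
      (pl.machine.run S pl.mainSlots (fun v => pl.machine.init v) v).acc ∪
        (pl.machine.run S pl.mainSlots (fun v => pl.machine.init v) v).roster = ids S := by
  set Q := pl.alive (ids S) pl.top with hQdef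
  have hQ : Q ⊆ ids S := alive_subset _
  have hrun : pl.machine.run S pl.mainSlots (fun v => pl.machine.init v) =
      pl.machine.run S (passSlots (2 ^ pl.top))
        (pl.machine.run S (callSlots (List.range (2 ^ pl.top))) (pl.configAt S pl.top)) := by
    rw [mainSlots, Machine.run_append, Machine.run_append]
    rfl
  have hc0 : Ready S Q fun v => (pl.configAt S pl.top v).roster := fun v hv =>
    roster_configAt_top hpl hN hv
  have hacc0 : ∀ v ∈ S, (pl.configAt S pl.top v).acc ⊆ ids S := fun v hv => by
    rw [(informed_configAt hpl hN le_rfl).2 v hv]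
    exact empty_subset _
  have hlt : ∀ x ∈ ids S, x < 2 ^ pl.top := fun x hx => by
    obtain ⟨u, _, rfl⟩ := mem_ids.1 hx
    exact u.2.trans_le hN
  have h1 := run_calls (pl := pl) (List.range (2 ^ pl.top)) _ hc0 hacc0
  set c1 := pl.machine.run S (callSlots (List.range (2 ^ pl.top))) (pl.configAt S pl.top)
  have hc1 : Ready S Q fun v => (c1 v).roster := fun v hv => by
    simp only [(h1 v hv).1]
    exact hc0 v hv
  have h2 := run_passes (pl := pl) hQ hc1 (fun v hv => (h1 v hv).2.2.1)
    (fun v hv hvQ x hx hr => (h1 v hv).2.2.2 hvQ x hx (List.mem_range.2 (hlt x hx)) hr)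
    (2 ^ pl.top)
  rw [hrun]
  refine ⟨fun v hv => ?_, fun v hv hvQ hr => ?_⟩
  · simp only [(h2 v hv).1]
    exact hc1 v hv
  · obtain ⟨h3, _, h5, h6⟩ := h2 v hv
    have h4 : (c1 v).roster = Q := (hc1 v hv).1 hvQ
    rw [h3, h4]
    refine subset_antisymm (union_subset h5 hQ) fun x hx => h6 hvQ ?_ x hx ?_
    · have : Q.card ≤ (range (2 ^ pl.top)).card :=
        card_le_card fun y hy => mem_range.2 (hlt y (hQ hy))
      rw [card_range] at this
      omega
    -- `hload` ensures that every called ID is assigned to an existing rank.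
    · have : x / pl.load < Q.card := Nat.div_lt_of_lt_mul ((hlt x hx).trans_le hload)
      omega

/-! ### Energy of the final phase -/

theorem card_div_eq_le (n w r : ℕ) (hw : 0 < w) :
    ((range n).filter fun x => r = x / w).card ≤ w := by
  refine (card_le_card (t := Ico (r * w) (r * w + w)) fun x hx => ?_).trans (by simp)
  have h := (mem_filter.1 hx).2
  rw [mem_Ico, h]
  exact ⟨Nat.div_mul_le_self x w, Nat.lt_div_mul_add hw⟩

theorem spent_calls (hload : 0 < pl.load) (n : ℕ) (c : Fin N → Device) (v : Fin N) :
    pl.machine.spent S (callSlots (List.range n)) c v ≤ 1 + pl.load := by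
  set R := (c v).roster with hR
  set f : ℕ → ℕ := fun x => (if x = (v : ℕ) then 1 else 0) +
    if rank R v = x / pl.load then 1 else 0 with hf
  have h2 := pl.machine.spent_le S (v := v) (fun s => s.roster = R)
    (fun d => match d with | Slot.call x => f x | _ => 0) (callSlots (List.range n))
    (by
      intro d hd s x hs
      obtain ⟨u, _, rfl⟩ := List.mem_map.1 hd
      exact hs)
    (by
      intro d hd s hs
      obtain ⟨u, _, rfl⟩ := List.mem_map.1 hd
      simp only [machine, act, hs, hf]
      by_cases h3 : (v : ℕ) = u
      · rw [if_pos h3, if_pos h3.symm]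
        exact Nat.le_add_right _ _
      · rw [if_neg h3]
        by_cases h4 : (v : ℕ) ∈ R ∧ rank R v = u / pl.load
        · rw [if_pos h4, if_pos h4.2]
          exact Nat.le_add_left _ _
        · rw [if_neg h4]
          exact Nat.zero_le _)
    c rfl
  refine h2.trans ?_
  have h3 : ((callSlots (List.range n)).map
      fun d => match d with | Slot.call x => f x | _ => 0).sum = ∑ x ∈ range n, f x := by
    rw [← sum_map_range, callSlots, List.map_map]
    rfl
  rw [h3, hf, sum_add_distrib]
  refine Nat.add_le_add ?_ ?_
  · rw [sum_ite_eq']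
    split_ifs <;> simp
  · rw [← card_filter]
    exact card_div_eq_le n _ _ hload

theorem spent_passes (n : ℕ) (c : Fin N → Device) (v : Fin N) :
    pl.machine.spent S (passSlots n) c v ≤ 2 := by
  set R := (c v).roster with hR
  set f : ℕ → ℕ := fun r => (if r = rank R v then 1 else 0) +
    -- For rank 0 the truncated subtraction only overcounts.
    if r = rank R v - 1 then 1 else 0 with hf
  have h2 := pl.machine.spent_le S (v := v) (fun s => s.roster = R)
    (fun d => match d with | Slot.pass x => f x | _ => 0) (passSlots n)
    (by
      intro d hd s x hs
      obtain ⟨u, _, rfl⟩ := List.mem_map.1 hd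
      exact hs)
    (by
      intro d hd s hs
      obtain ⟨u, _, rfl⟩ := List.mem_map.1 hd
      simp only [machine, act, hs, hf]
      by_cases h3 : rank R v = u
      · rw [if_pos h3.symm]
        refine le_trans ?_ (Nat.le_add_right _ _)
        split_ifs <;> simp [SlotAction.cost]
      · rw [if_neg fun h => h3 h.2]
        by_cases h4 : rank R v = u + 1
        · rw [if_pos (show u = rank R v - 1 by omega)]
          refine le_trans ?_ (Nat.le_add_left _ _)
          split_ifs <;> simp [SlotAction.cost]
        · rw [if_neg fun h => h4 h.2]
          exact Nat.zero_le _)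
    c rfl
  refine h2.trans ?_
  have h3 : ((passSlots n).map
      fun d => match d with | Slot.pass x => f x | _ => 0).sum = ∑ x ∈ range n, f x := by
    rw [← sum_map_range, passSlots, List.map_map]
    rfl
  rw [h3, hf, sum_add_distrib, sum_ite_eq', sum_ite_eq']
  split_ifs <;> simp

theorem spent_slots (hpl : pl.Sound (ids S) E) (hN : N ≤ 2 ^ pl.top) (hload : 0 < pl.load)
    {v : Fin N} (hv : v ∈ S) :
    pl.machine.spent S pl.slots (fun v => pl.machine.init v) v ≤ 3 * E + pl.load + 6 := by
  have h1 := spent_slotsBelow_top hpl hN hv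
  have h2 := spent_calls (S := S) hload (2 ^ pl.top) (pl.configAt S pl.top) v
  have h3 := spent_passes (pl := pl) (S := S) (2 ^ pl.top)
    (pl.machine.run S (callSlots (List.range (2 ^ pl.top))) (pl.configAt S pl.top)) v
  have h4 : ∀ c : Fin N → Device, pl.machine.spent S [Slot.announce] c v ≤ 1 := fun c => by
    simp only [Machine.spent, Machine.acts, machine, act]
    split_ifs <;> simp [SlotAction.cost]
  rw [slots, mainSlots, Machine.spent_append, Machine.spent_append, Machine.spent_append]
  have h5 := h4 (pl.machine.run S (pl.slotsBelow pl.top ++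
    (callSlots (List.range (2 ^ pl.top)) ++ passSlots (2 ^ pl.top))) fun v => pl.machine.init v)
  change _ + (pl.machine.spent S _ (pl.configAt S pl.top) v +
    pl.machine.spent S _ (pl.machine.run S _ (pl.configAt S pl.top)) v) + _ ≤ _
  omega

/-! ### Running time -/

theorem length_levelSlots (l : ℕ) : (pl.levelSlots l).length = 2 ^ (pl.top - l) + 1 := by
  simp [levelSlots, reports]

theorem length_slotsBelow {l : ℕ} (hl : l ≤ pl.top) :
    (pl.slotsBelow l).length + 2 * 2 ^ (pl.top - l) = 2 * 2 ^ pl.top + l := by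
  induction l with
  | zero => simp [slotsBelow]
  | succ l ih =>
    have h := ih (by omega)
    have h2 : 2 ^ (pl.top - l) = 2 * 2 ^ (pl.top - (l + 1)) := by
      rw [← pow_succ']
      congr 1
      omega
    rw [slotsBelow, List.length_append, length_levelSlots]
    omega

theorem length_slots_le : pl.slots.length ≤ 5 * 2 ^ pl.top := by
  have h1 := length_slotsBelow (pl := pl) le_rfl
  have h2 := Nat.lt_two_pow_self (n := pl.top)
  rw [Nat.sub_self, pow_zero] at h1
  simp only [slots, mainSlots, callSlots, passSlots, List.length_append, List.length_map,
    List.length_range, List.length_singleton]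
  omega

/-- The algorithm that follows a plan for each size of the ID space. -/
noncomputable def algorithm (pl : ℕ → Plan) : Algorithm :=
  Machine.toAlgorithm (fun N => (pl N).machine) fun N => (pl N).slots

theorem algorithm_solves (pl : ℕ → Plan) (hpl : (pl N).Sound (ids S) E)
    (hN : N ≤ 2 ^ (pl N).top)
    (hload : 2 ^ (pl N).top ≤ (pl N).load * ((pl N).alive (ids S) (pl N).top).card) :
    (algorithm pl).SolvesLeaderElection S ∧ (algorithm pl).SolvesCensus S := by
  obtain ⟨hready, hacc⟩ := run_mainSlots hpl hN hload
  set Q := (pl N).alive (ids S) (pl N).top with hQdef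
  have hQ0 : 0 < Q.card := by
    rcases Nat.eq_zero_or_pos Q.card with h | h
    · rw [h, mul_zero] at hload
      exact absurd hload (by simp)
    · exact h
  obtain ⟨y, hy, hyr⟩ := exists_rank_eq (P := Q) (r := Q.card - 1) (by omega)
  obtain ⟨v, hv, rfl⟩ := mem_ids.1 (alive_subset _ hy)
  have hvr : rank Q v + 1 = Q.card := by omega
  have hacc := hacc v hv hy hvr
  set c := (pl N).machine.run S (pl N).mainSlots (fun v => (pl N).machine.init v) with hc
  have hlead : ∀ w ∈ S, ((w : ℕ) ∈ (c w).roster ∧ rank (c w).roster w + 1 = (c w).roster.card) ↔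
      w = v := by
    intro w hw
    constructor
    · rintro ⟨h1, h2⟩
      have hwQ := (hready.mem_iff hw).1 h1
      have h3 : (c w).roster = Q := (hready w hw).1 hwQ
      rw [h3] at h2
      exact Fin.ext (rank_injOn Q hwQ hy (by omega))
    · rintro rfl
      have h3 : (c w).roster = Q := (hready w hw).1 hy
      rw [h3]
      exact ⟨hy, hvr⟩
  have hlen : (pl N).slots.length = (pl N).mainSlots.length + 1 := by simp [slots]
  have haction : ∀ w, (algorithm pl).action S (pl N).mainSlots.length w =
      (pl N).machine.acts Slot.announce c w := by
    intro w
    have h := Machine.action_eq S (fun N => (pl N).machine) (fun N => (pl N).slots) (N := N)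
      (t := (pl N).mainSlots.length) (by rw [hlen]; exact Nat.lt_succ_self _) w
    have h2 : Machine.config S (fun N => (pl N).machine) (fun N => (pl N).slots)
        (pl N).mainSlots.length = c := by
      simp [Machine.config, slots, hc]
    rw [algorithm, h, h2]
    simp [slots]
  have hann : (algorithm pl).Announces S (pl N).mainSlots.length v ((ids S).sort (· ≤ ·)) := by
    refine ⟨?_, fun w hw hwv => ?_⟩
    · rw [haction]
      simp only [Machine.acts, machine, act]
      rw [if_pos ((hlead v hv).2 rfl), hacc]
    · rw [haction]
      simp only [Machine.acts, machine, act]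
      rw [if_neg fun h => hwv ((hlead w hw).1 h)]
  have htime : (algorithm pl).time N = (pl N).mainSlots.length + 1 := hlen
  -- The announcement leaves rosters unchanged and the role ignores `acc`, so `∅` may stand in for
  -- it.
  have hrole : ∀ w ∈ S, (algorithm pl).finalRole S w =
      (pl N).machine.role w ⟨(c w).roster, ∅⟩ := by
    intro w _
    rw [algorithm, Machine.finalRole_eq, slots, Machine.run_append]
    rfl
  refine ⟨⟨v, hv, ?_, fun w hw hwv => ?_, _, _, htime, hann⟩,
    ⟨v, hv, _, _, htime, hann, sort_nodup _ _, fun x => ?_⟩⟩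
  · rw [hrole v hv]
    simp only [machine]
    rw [if_pos ((hlead v hv).2 rfl)]
  · rw [hrole w hw]
    simp only [machine]
    rw [if_neg fun h => hwv ((hlead w hw).1 h)]
  · rw [mem_sort, mem_ids]

end Plan

/-! ### The choice of the parameters -/

theorem le_ack_inverseAck (N : ℕ) : N ≤ ack (inverseAck N) (inverseAck N) :=
  Nat.find_spec (p := fun i => N ≤ ack i i) ⟨N, (lt_ack_left N N).le⟩

theorem one_le_inverseAck {N : ℕ} (hN : 2 ≤ N) : 1 ≤ inverseAck N := by
  by_contra h
  have h1 := le_ack_inverseAck N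
  rw [show inverseAck N = 0 by omega, ack_zero] at h1
  omega

theorem ack_self_le (i : ℕ) : ack i i ≤ ack (i + 1) 1 := by
  rw [ack_succ_eq_iterate]
  exact ack_le_ack le_rfl (lt_ack_left i 1).le

/-- One order beyond `inverseAck N` replaces the diagonal argument by 1 (`ack_self_le`), so a
constant starting level suffices. -/
theorem le_finish (N : ℕ) {β : ℕ} (hβ : 4 ≤ β) : N ≤ finish (inverseAck N + 1) (2 * β) 0 := by
  have h := ack_le_finish (inverseAck N + 1) (2 * β) 0 (by omega)
  have h1 : ack (inverseAck N + 1) 1 ≤ ack (inverseAck N + 1) (2 * β / 2 - 0) :=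
    ack_le_ack le_rfl (by omega)
  have h2 := ack_self_le (inverseAck N)
  have h3 := le_ack_inverseAck N
  omega

/-- The plan for ID space `{0, …, N - 1}`. -/
def plan (β w N : ℕ) : Plan where
  path l := if l < 2 * β ∨ Nat.clog 2 N ≤ l then [] else route (inverseAck N + 1) (2 * β) 0 l
  thr l := if l < 2 * β then 1 else 2 ^ (l / 2)
  top := Nat.clog 2 N
  load := w

theorem clog_le_self (N : ℕ) : Nat.clog 2 N ≤ N :=
  Nat.clog_le_of_le_pow (Nat.lt_two_pow_self).le

theorem two_pow_clog_le {N : ℕ} (hN : 2 ≤ N) : 2 ^ Nat.clog 2 N ≤ 2 * N := by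
  have h := Nat.pow_pred_clog_lt_self (b := 2) (by norm_num) (x := N) (by omega)
  have h1 : 0 < Nat.clog 2 N := Nat.clog_pos (by norm_num) hN
  obtain ⟨d, hd⟩ : ∃ d, Nat.clog 2 N = d + 1 := ⟨Nat.clog 2 N - 1, by omega⟩
  rw [hd, Nat.pred_succ] at h
  rw [hd, pow_succ]
  omega

variable {β w N : ℕ}

theorem plan_path_of_mem {l : ℕ} {s : Split} (hs : s ∈ (plan β w N).path l) :
    2 * β ≤ l ∧ l < Nat.clog 2 N := by
  by_contra h
  have h1 : (plan β w N).path l = [] := if_pos (by omega)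
  rw [h1] at hs
  simp at hs

theorem plan_path_eq {l : ℕ} (h1 : 2 * β ≤ l) (h2 : l < Nat.clog 2 N) :
    (plan β w N).path l = route (inverseAck N + 1) (2 * β) 0 l :=
  if_neg (by omega)

/-- The summands bound the waking levels below `2 * β`, those in the phase of order `inverseAck N +
1`, and the top level. The phase starts with all devices, so `q = 0`. -/
theorem plan_sound (hβ : 4 ≤ β) (X : Finset ℕ) :
    (plan β w N).Sound X (2 * β + (3 * (inverseAck N + 1) + 2) + 1) where
  consistent l hl p p' s h := by
    obtain ⟨h1, h2⟩ := plan_path_of_mem (β := β) (w := w) (N := N) (l := l) (s := s) (by simp [h])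
    rw [plan_path_eq h1 h2] at h
    obtain ⟨h3, h4, h5⟩ := route_consistent _ _ _ l h1
      (h2.trans_le ((clog_le_self N).trans (le_finish N hβ))) p p' s h
    exact ⟨h4, by rw [plan_path_eq h3 (h4.trans h2), h5]⟩
  path_zero := if_pos (by omega)
  path_top := if_pos (Or.inr le_rfl)
  exists_awake l hl v hv := by
    by_cases h : 2 * β ≤ l ∧ l < Nat.clog 2 N
    · have hthick : Thick (2 * β) l ((plan β w N).alive X l) := by
        intro k h1 h2 u hu
        have h3 := Plan.thr_le_card_cell (by omega) h2 hu
        have h4 : (plan β w N).thr k = 2 ^ (k / 2) := if_neg (by omega)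
        rwa [h4] at h3
      rw [Plan.awake, plan_path_eq h.1 h.2]
      exact exists_awake hthick _ _ 0 _ l subset_rfl (fun u _ => by simp) le_rfl h.1
        (h.2.trans_le ((clog_le_self N).trans (le_finish N hβ))) le_rfl v hv
    · have h1 : (plan β w N).path l = [] := if_pos (by omega)
      exact ⟨v, by rwa [Plan.awake, h1], rfl⟩
  card_awake P v := by
    set A := (Ico (2 * β) (finish (inverseAck N + 1) (2 * β) 0)).filter
      fun l => v ∈ team (route (inverseAck N + 1) (2 * β) 0 l) P with hA
    have hsub : ((range ((plan β w N).top + 1)).filter fun l => v ∈ (plan β w N).awake l P) ⊆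
        (range (2 * β) ∪ A) ∪ {Nat.clog 2 N} := by
      intro l hl
      obtain ⟨hl0, h3⟩ := mem_filter.1 hl
      have hl1 : l < Nat.clog 2 N + 1 := mem_range.1 hl0
      simp only [mem_union, mem_range, mem_singleton]
      by_cases h1 : l < 2 * β
      · exact Or.inl (Or.inl h1)
      · by_cases h2 : l = Nat.clog 2 N
        · exact Or.inr h2
        · rw [Plan.awake, plan_path_eq (by omega) (by omega)] at h3
          have h4 := (clog_le_self N).trans (le_finish N hβ)
          exact Or.inl (Or.inr (mem_filter.2 ⟨mem_Ico.2 ⟨by omega, by omega⟩, h3⟩))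
    have h1 := card_le_card hsub
    have h2 := card_union_le (range (2 * β) ∪ A) {Nat.clog 2 N}
    have h3 := card_union_le (range (2 * β)) A
    have h4 : A.card ≤ 3 * (inverseAck N + 1) + 2 := card_route_le _ _ _ _ _
    rw [card_singleton] at h2
    rw [card_range] at h3
    omega

namespace Plan

/-- Only few devices are lost in each level. -/
theorem card_alive_le {pl : Plan} {X : Finset ℕ} (hX : ∀ x ∈ X, x < 2 ^ pl.top) {l : ℕ}
    (hl : l + 1 ≤ pl.top) : (pl.alive X l).card ≤
      (pl.alive X (l + 1)).card + pl.thr (l + 1) * 2 ^ (pl.top - (l + 1)) := by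
  rw [← card_filter_add_card_filter_not
    (fun v => pl.thr (l + 1) ≤ (cell (l + 1) v (pl.alive X l)).card)]
  refine Nat.add_le_add_left ?_ _
  have h := card_le_mul_card_image_of_maps_to
    (s := (pl.alive X l).filter fun v => ¬ pl.thr (l + 1) ≤ (cell (l + 1) v (pl.alive X l)).card)
    (t := range (2 ^ (pl.top - (l + 1)))) (f := fun v => v / 2 ^ (l + 1)) (fun v hv => by
      refine mem_range.2 (Nat.div_lt_of_lt_mul ?_)
      rw [← pow_add, Nat.add_sub_cancel' hl]
      exact hX v (alive_subset _ (mem_filter.1 hv).1)) (pl.thr (l + 1)) (fun u _ => by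
      rcases eq_empty_or_nonempty (((pl.alive X l).filter fun v =>
        ¬ pl.thr (l + 1) ≤ (cell (l + 1) v (pl.alive X l)).card).filter
          fun v => v / 2 ^ (l + 1) = u) with h0 | ⟨v, hv⟩
      · rw [h0]
        exact Nat.zero_le _
      · simp only [mem_filter, not_le] at hv
        obtain ⟨⟨hv1, hv2⟩, rfl⟩ := hv
        exact (card_le_card (filter_subset_filter _ (filter_subset _ _))).trans hv2.le)
  rwa [card_range] at h

end Plan

theorem alive_plan_of_lt {X : Finset ℕ} {l : ℕ} (hl : l < 2 * β) :
    (plan β w N).alive X l = X := by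
  induction l with
  | zero => rfl
  | succ l ih =>
    have h : (plan β w N).thr (l + 1) = 1 := if_pos hl
    rw [Plan.alive, ih (by omega), h]
    exact filter_true_of_mem fun v hv => card_pos.2 ⟨v, mem_cell_self.2 hv⟩

/-- The second term on the left is a potential bounding all later losses. Passing from `l` to `l +
1` costs at most `2 ^ g / 2 ^ ((l + 2) / 2)`, `g = Nat.clog 2 N`, and the parity term makes the
potential drop by exactly that; at `l = 2 * β - 1` it equals `3 * 2 ^ g / 2 ^ β`. -/
theorem card_le_card_alive_add {X : Finset ℕ} (hX : ∀ x ∈ X, x < 2 ^ Nat.clog 2 N)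
    {l : ℕ} (h1 : 2 * β ≤ l + 1) (hβ : 0 < β) (h2 : l ≤ Nat.clog 2 N) :
    (X.card : ℝ) + 2 ^ Nat.clog 2 N * ((4 - (l % 2 : ℕ)) / 2 ^ ((l + 2) / 2)) ≤
      ((plan β w N).alive X l).card + 3 * 2 ^ Nat.clog 2 N / 2 ^ β := by
  obtain ⟨b, rfl⟩ : ∃ b, β = b + 1 := ⟨β - 1, by omega⟩
  obtain ⟨n, rfl⟩ := Nat.exists_eq_add_of_le (show 2 * b + 1 ≤ l by omega)
  induction n with
  | zero =>
    rw [alive_plan_of_lt (by omega), show (2 * b + 1 + 0) % 2 = 1 by omega,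
      show (2 * b + 1 + 0 + 2) / 2 = b + 1 by omega]
    apply le_of_eq
    push_cast
    ring
  | succ n ih =>
    have h3 := ih (by omega) (by omega)
    set l := 2 * b + 1 + n with hl
    set g := Nat.clog 2 N with hg
    have h4 := Plan.card_alive_le (pl := plan (b + 1) w N) (X := X) (l := l) hX h2
    have h5 : (plan (b + 1) w N).thr (l + 1) = 2 ^ ((l + 1) / 2) := if_neg (by omega)
    have h6 : (2 : ℝ) ^ ((l + 1) / 2) * 2 ^ (g - (l + 1)) = 2 ^ g / 2 ^ ((l + 2) / 2) := by
      rw [eq_div_iff (by positivity), ← pow_add, ← pow_add]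
      congr 1
      omega
    have h7 : (((plan (b + 1) w N).alive X l).card : ℝ) ≤
        ((plan (b + 1) w N).alive X (l + 1)).card + 2 ^ g / 2 ^ ((l + 2) / 2) := by
      rw [← h6]
      rw [h5] at h4
      exact_mod_cast h4
    have h8 : ((4 : ℝ) - ((l + 1) % 2 : ℕ)) / 2 ^ ((l + 1 + 2) / 2) + 1 / 2 ^ ((l + 2) / 2) =
        (4 - (l % 2 : ℕ)) / 2 ^ ((l + 2) / 2) := by
      rcases Nat.even_or_odd' l with ⟨m, hm | hm⟩
      · rw [show (l + 1) % 2 = 1 by omega, show l % 2 = 0 by omega,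
          show (l + 1 + 2) / 2 = m + 1 by omega, show (l + 2) / 2 = m + 1 by omega]
        push_cast
        ring
      · rw [show (l + 1) % 2 = 0 by omega, show l % 2 = 1 by omega,
          show (l + 1 + 2) / 2 = m + 1 + 1 by omega, show (l + 2) / 2 = m + 1 by omega]
        push_cast
        rw [pow_succ (2 : ℝ) (m + 1)]
        field_simp
        norm_num
    have h9 : (2 : ℝ) ^ g * (((4 : ℝ) - ((l + 1) % 2 : ℕ)) / 2 ^ ((l + 1 + 2) / 2)) +
        2 ^ g / 2 ^ ((l + 2) / 2) = 2 ^ g * ((4 - (l % 2 : ℕ)) / 2 ^ ((l + 2) / 2)) := by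
      rw [← h8]
      ring
    rw [show 2 * b + 1 + (n + 1) = l + 1 by omega]
    linarith

/-- In a dense set of devices many survive. -/
theorem card_alive_top {c : ℝ} (hc : 0 < c) (hβ : 0 < β) (hβc : 12 / c ≤ 2 ^ β) (hN : 2 ≤ N)
    {X : Finset ℕ} (hX : ∀ x ∈ X, x < N) (hcard : c * N ≤ X.card) :
    c * N / 2 ≤ ((plan β w N).alive X (plan β w N).top).card := by
  have hg : (2 : ℝ) ^ Nat.clog 2 N ≤ 2 * N := by exact_mod_cast two_pow_clog_le hN
  have hX' : ∀ x ∈ X, x < 2 ^ Nat.clog 2 N := fun x hx =>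
    (hX x hx).trans_le (Nat.le_pow_clog (by norm_num) N)
  change _ ≤ (((plan β w N).alive X (Nat.clog 2 N)).card : ℝ)
  by_cases h : Nat.clog 2 N < 2 * β
  · rw [alive_plan_of_lt h]
    have : 0 ≤ c * N := by positivity
    linarith
  · have h1 := card_le_card_alive_add (w := w) hX' (l := Nat.clog 2 N) (by omega) hβ le_rfl
    have h2 : (0 : ℝ) ≤ 2 ^ Nat.clog 2 N *
        ((4 - (Nat.clog 2 N % 2 : ℕ)) / 2 ^ ((Nat.clog 2 N + 2) / 2)) := by
      have : ((Nat.clog 2 N % 2 : ℕ) : ℝ) ≤ 1 := by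
        exact_mod_cast Nat.lt_succ_iff.1 (Nat.mod_lt _ (by norm_num))
      have h3 : (0 : ℝ) ≤ 4 - (Nat.clog 2 N % 2 : ℕ) := by linarith
      positivity
    -- The 12 in `hβc` arises here: `3 * 2 ^ clog ≤ 6 * N`, to be at most half of `c * N * 2 ^ β`.
    have h4 : (3 : ℝ) * 2 ^ Nat.clog 2 N / 2 ^ β ≤ c * N / 2 := by
      rw [div_le_iff₀ (by positivity)]
      rw [div_le_iff₀ hc] at hβc
      have h5 : (12 : ℝ) * N ≤ 2 ^ β * c * N := by gcongr
      nlinarith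
    linarith

theorem exists_algorithm (c : ℝ) (hc : 0 < c) : ∃ A : Algorithm, ∃ C : ℕ,
    ∀ (N : ℕ) (S : Finset (Fin N)), 2 ≤ S.card → c * (N : ℝ) ≤ (S.card : ℝ) →
      A.SolvesLeaderElection S ∧ A.SolvesCensus S ∧
      (∀ v ∈ S, A.energy S v ≤ C * inverseAck N) ∧ A.time N ≤ C * N := by
  obtain ⟨β₀, hβ₀⟩ := pow_unbounded_of_one_lt (12 / c) (one_lt_two (α := ℝ))
  -- At least `c * N / 2` survivors must share up to `2 * N` call slots.
  obtain ⟨w, hw⟩ := exists_nat_gt (4 / c)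
  set β := β₀ + 4 with hβ
  have hβc : 12 / c ≤ 2 ^ β :=
    hβ₀.le.trans (pow_le_pow_right₀ one_le_two (Nat.le_add_right _ _))
  have hw0 : 0 < w := by
    have : (0 : ℝ) < w := lt_trans (by positivity) hw
    exact_mod_cast this
  -- The energy bound expands to `6 * β + w + 24 + 9 * inverseAck N`, and `1 ≤ inverseAck N` absorbs
  -- the constant part.
  refine ⟨Plan.algorithm (plan β w), 6 * β + w + 33, fun N S hS hcS => ?_⟩
  have hN : 2 ≤ N := hS.trans ((card_le_univ S).trans_eq (Fintype.card_fin N))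
  have hNpow : N ≤ 2 ^ (plan β w N).top := Nat.le_pow_clog (by norm_num) N
  have htop : 2 ^ (plan β w N).top ≤ 2 * N := two_pow_clog_le hN
  have hsound := plan_sound (w := w) (N := N) (show 4 ≤ β by omega) (ids S)
  have halive := card_alive_top (w := w) hc (show 0 < β by omega) hβc hN (X := ids S)
    (fun x hx => by obtain ⟨u, _, rfl⟩ := mem_ids.1 hx; exact u.2) (by rwa [ids, card_map])
  have hload : 2 ^ (plan β w N).top ≤
      (plan β w N).load * ((plan β w N).alive (ids S) (plan β w N).top).card := by
    refine htop.trans ?_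
    have h1 : (2 * N : ℝ) ≤ w * ((plan β w N).alive (ids S) (plan β w N).top).card := by
      calc (2 * N : ℝ) = 4 / c * (c * N / 2) := by field_simp; norm_num
        _ ≤ w * ((plan β w N).alive (ids S) (plan β w N).top).card := by
          gcongr
    exact_mod_cast h1
  obtain ⟨hle, hcen⟩ := Plan.algorithm_solves (plan β w) hsound hNpow hload
  refine ⟨hle, hcen, fun v hv => ?_, ?_⟩
  · have h1 : (Plan.algorithm (plan β w)).energy S v ≤ _ :=
      (Machine.energy_eq S (fun N => (plan β w N).machine) (fun N => (plan β w N).slots)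
        v).trans_le (Plan.spent_slots hsound hNpow hw0 hv)
    refine h1.trans ?_
    have h2 := one_le_inverseAck hN
    have h3 : (plan β w N).load = w := rfl
    have h4 : 6 * β + w + 24 ≤ (6 * β + w + 24) * inverseAck N := Nat.le_mul_of_pos_right _ h2
    rw [h3]
    have h5 : (6 * β + w + 33) * inverseAck N =
        (6 * β + w + 24) * inverseAck N + 9 * inverseAck N := by ring
    omega
  · have h1 : (Plan.algorithm (plan β w)).time N ≤ 5 * 2 ^ (plan β w N).top :=
      Plan.length_slots_le
    have h2 : 10 * N ≤ (6 * β + w + 33) * N := Nat.mul_le_mul_right _ (by omega)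
    omega

end NoCD

theorem mainTheorem5 :
    (∀ c : ℝ, 0 < c → ∃ A : NoCD.Algorithm, ∃ C : ℕ,
      ∀ (N : ℕ) (S : Finset (Fin N)), 2 ≤ S.card → c * (N : ℝ) ≤ (S.card : ℝ) →
        A.SolvesLeaderElection S ∧ A.SolvesCensus S ∧
        (∀ v ∈ S, A.energy S v ≤ C * NoCD.inverseAck N) ∧
        A.time N ≤ C * N) ∧
    (∀ i j : ℕ, 32 < j → ack i j ≤ NoCD.growthA i j ∧ ack i j ≤ NoCD.growthB i j) :=
  ⟨NoCD.exists_algorithm, NoCD.ack_le_growth⟩
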